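/- Let $N\ge 1$, $p\in[1,\infty)$ and $I=(0,1)$. Let $K\colon\mathbb R^N\to[0,\infty]$ be a measurable function which does not vanish almost everywhere, such that $\int_{\mathbb R^N}|x|^pK(x)\,dx<\infty$, and let $\beta\colon I\to(0,\infty)$ be a Borel function with $\lim_{t\to0^+}\beta(t)=\infty$. For $t\in I$ and $x\in\mathbb R^N$ set $$K_t(x)=\beta(t)^N K(\beta(t)x),\qquad m(R)=\int_{B_R}|x|^pK(x)\,dx,\qquad \phi(t)=\frac{m(\beta(t))}{\beta(t)^p},\qquad \rho_t(x)=\frac{|x|^pK_t(x)}{\phi(t)}$$ (note that $\phi(t)>0$ for all sufficiently small $t$; for the remaining $t$, the quotient is understood in $[0,\infty]$ with $a/0=\infty$ for $a>0$ and $0/0=0$) and, for $u\in L^p(\mathbb R^N)$, $$F_{t,p}(u)=\int_{\mathbb R^N}\int_{\mathbb R^N}\frac{|u(x)-u(y)|^p}{|x-y|^p}\,\rho_t(x-y)\,dx\,dy\in[0,\infty].$$ Let $(t_k)_{k\in\mathbb N}\subset I$ with $t_k\to0$ and let $(u_k)_{k\in\mathbb N}\subset L^p(\mathbb R^N)$ be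 such that $$\sup_{k\in\mathbb N}\big(\|u_k\|_{L^p}+F_{t_k,p}(u_k)\big)<\infty.$$ Then: 1. $(u_k)_{k\in\mathbb N}$ is locally precompact in $L^p(\mathbb R^N)$, that is, for every compact set $E\subset\mathbb R^N$ the set of restrictions $\{u_k|_E:k\in\mathbb N\}$ is relatively compact in $L^p(E)$; 2. if $v\in L^p_{\rm loc}(\mathbb R^N)$ is the limit in $L^p_{\rm loc}(\mathbb R^N)$ of some subsequence of $(u_k)_{k\in\mathbb N}$, then $v\in W^{1,p}(\mathbb R^N)$ if $p>1$, and $v\in BV(\mathbb R^N)$ if $p=1$. Here $v\in W^{1,p}(\mathbb R^N)$ means that $v\in L^p(\mathbb R^N)$ and its distributional gradient is in $L^p(\mathbb R^N;\mathbb R^N)$, and $v\in BV(\mathbb R^N)$ means that $v\in L^1(\mathbb R^N)$ and its distributional gradient is a finite $\mathbb R^N$-valued Radon measure. -/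

import Mathlib

open Set Filter Topology MeasureTheory
open scoped ENNReal ContDiff

noncomputable section

namespace BBM

/-- `IsTestFunction φ`: `φ` is a smooth, compactly supported real function on `ℝ^N`. -/
def IsTestFunction {N : ℕ} (φ : EuclideanSpace ℝ (Fin N) → ℝ) : Prop :=
  ContDiff ℝ ∞ φ ∧ HasCompactSupport φ

/-- The `i`-th classical partial derivative of `φ` at `x`. -/
def partialDeriv {N : ℕ} (i : Fin N) (φ : EuclideanSpace ℝ (Fin N) → ℝ)
    (x : EuclideanSpace ℝ (Fin N)) : ℝ :=
  fderiv ℝ φ x (EuclideanSpace.single i 1)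

/-- `u ∈ W^{1,p}(ℝ^N)`: `u ∈ L^p` and the distributional gradient of `u` is (represented by) a
vector field `g ∈ L^p(ℝ^N; ℝ^N)`. -/
def MemW1p {N : ℕ} (p : ℝ≥0∞) (u : EuclideanSpace ℝ (Fin N) → ℝ) : Prop :=
  MemLp u p volume ∧
    ∃ g : EuclideanSpace ℝ (Fin N) → EuclideanSpace ℝ (Fin N),
      MemLp g p volume ∧
        ∀ (i : Fin N) (φ : EuclideanSpace ℝ (Fin N) → ℝ), IsTestFunction φ →
          ∫ x, u x * partialDeriv i φ x = -∫ x, g x i * φ x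

/-- `u ∈ BV(ℝ^N)`: `u ∈ L^1` and the distributional gradient of `u` is (represented by) a finite
`ℝ^N`-valued Radon measure, given here by its components, which are finite signed Borel measures.
(A `SignedMeasure` is real-valued, hence of finite total variation, so every test function is
integrable with respect to it.) -/
def MemBV {N : ℕ} (u : EuclideanSpace ℝ (Fin N) → ℝ) : Prop :=
  MemLp u 1 volume ∧
    ∃ Du : Fin N → SignedMeasure (EuclideanSpace ℝ (Fin N)),
      ∀ (i : Fin N) (φ : EuclideanSpace ℝ (Fin N) → ℝ), IsTestFunction φ →
        ∫ x, u x * partialDeriv i φ x = -∫ᵛ x, φ x ∂<•(Du i)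

/-- The space `S^p(ℝ^N)`, which is `W^{1,p}(ℝ^N)` for `p > 1` and `BV(ℝ^N)` for `p = 1`. -/
def MemS {N : ℕ} (p : ℝ≥0∞) (u : EuclideanSpace ℝ (Fin N) → ℝ) : Prop :=
  if p = 1 then MemBV u else MemW1p p u

/-- The truncated `p`-th moment `m_{K,p}(R) = ∫_{B_R} |x|^p K(x) dx`. -/
def moment {N : ℕ} (p : ℝ≥0∞) (K : EuclideanSpace ℝ (Fin N) → ℝ≥0∞) (R : ℝ) : ℝ≥0∞ :=
  ∫⁻ x in Metric.ball 0 R, ‖x‖ₑ ^ p.toReal * K x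

/-- The normalization `φ_{K,β,p}(t) = m_{K,p}(β(t)) / β(t)^p`. -/
def phi {N : ℕ} (p : ℝ≥0∞) (K : EuclideanSpace ℝ (Fin N) → ℝ≥0∞) (β : ℝ → ℝ) (t : ℝ) : ℝ≥0∞ :=
  moment p K (β t) / ENNReal.ofReal (β t) ^ p.toReal

/-- The rescaled kernel `K_t(x) = β(t)^N K(β(t) x)`. -/
def scaledKernel {N : ℕ} (K : EuclideanSpace ℝ (Fin N) → ℝ≥0∞) (β : ℝ → ℝ) (t : ℝ)
    (x : EuclideanSpace ℝ (Fin N)) : ℝ≥0∞ :=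
  ENNReal.ofReal (β t) ^ N * K (β t • x)

/-- The kernel `ρ_t(x) = |x|^p K_t(x) / φ_{K,β,p}(t)`. -/
def rho {N : ℕ} (p : ℝ≥0∞) (K : EuclideanSpace ℝ (Fin N) → ℝ≥0∞) (β : ℝ → ℝ) (t : ℝ)
    (x : EuclideanSpace ℝ (Fin N)) : ℝ≥0∞ :=
  ‖x‖ₑ ^ p.toReal * scaledKernel K β t x / phi p K β t

/-- The energy `F_p(u) = ∫∫ |u(x) - u(y)|^p / |x - y|^p ρ(x - y) dx dy ∈ [0, ∞]` associated with a
kernel `ρ`. -/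
def energy {N : ℕ} (p : ℝ≥0∞) (ρ : EuclideanSpace ℝ (Fin N) → ℝ≥0∞)
    (u : EuclideanSpace ℝ (Fin N) → ℝ) : ℝ≥0∞ :=
  ∫⁻ y, ∫⁻ x, ‖u x - u y‖ₑ ^ p.toReal / ‖x - y‖ₑ ^ p.toReal * ρ (x - y)

/-- `X ⊆ L^p(ℝ^N)` is locally precompact in `L^p(ℝ^N)`: for every compact `E`, the set of the
restrictions to `E` of the elements of `X` is relatively compact in `L^p(E)`. -/
def LocallyPrecompact {N : ℕ} (p : ℝ≥0∞) [Fact (1 ≤ p)]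
    (X : Set (Lp ℝ p (volume : Measure (EuclideanSpace ℝ (Fin N))))) : Prop :=
  ∀ E : Set (EuclideanSpace ℝ (Fin N)), IsCompact E →
    IsCompact (closure
      (LpToLpRestrictCLM (EuclideanSpace ℝ (Fin N)) ℝ ℝ volume p E '' X))

/-- `v ∈ L^p_loc(ℝ^N)`. -/
def MemLpLoc {N : ℕ} (p : ℝ≥0∞) (v : EuclideanSpace ℝ (Fin N) → ℝ) : Prop :=
  ∀ E : Set (EuclideanSpace ℝ (Fin N)), IsCompact E → MemLp v p (volume.restrict E)

/-- `w_j → v` in `L^p_loc(ℝ^N)`, that is, in `L^p(E)` for every compact `E`. -/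
def TendstoLpLoc {N : ℕ} (p : ℝ≥0∞) (w : ℕ → EuclideanSpace ℝ (Fin N) → ℝ)
    (v : EuclideanSpace ℝ (Fin N) → ℝ) : Prop :=
  ∀ E : Set (EuclideanSpace ℝ (Fin N)), IsCompact E →
    Tendsto (fun j => eLpNorm (fun x => w j x - v x) p (volume.restrict E)) atTop (𝓝 0)

end BBM

end

noncomputable section

namespace BBM

section Translation

variable {E : Type*} [NormedAddCommGroup E] [MeasurableSpace E] [BorelSpace E]

/-- The `L^p` distance between `u` and its translate by `h`. -/
def translationGap (μ : Measure E) (p : ℝ≥0∞) (u : E → ℝ) (h : E) : ℝ≥0∞ :=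
  eLpNorm (fun x => u (x + h) - u x) p μ

variable {μ : Measure E} [μ.IsAddRightInvariant] {p : ℝ≥0∞} {u : E → ℝ}

lemma aestronglyMeasurable_comp_add (hu : AEStronglyMeasurable u μ) (h : E) :
    AEStronglyMeasurable (fun x => u (x + h)) μ :=
  hu.comp_measurePreserving (measurePreserving_add_right μ h)

lemma eLpNorm_comp_add (hu : AEStronglyMeasurable u μ) (h : E) :
    eLpNorm (fun x => u (x + h)) p μ = eLpNorm u p μ :=
  eLpNorm_comp_measurePreserving hu (measurePreserving_add_right μ h)

lemma aestronglyMeasurable_add_sub (hu : AEStronglyMeasurable u μ) (h : E) :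
    AEStronglyMeasurable (fun x => u (x + h) - u x) μ :=
  (aestronglyMeasurable_comp_add hu h).sub hu

@[simp]
lemma translationGap_zero {μ : Measure E} : translationGap μ p u 0 = 0 := by
  simp [translationGap]

lemma translationGap_add_le (hp : 1 ≤ p) (hu : AEStronglyMeasurable u μ) (h k : E) :
    translationGap μ p u (h + k) ≤ translationGap μ p u h + translationGap μ p u k := by
  have h1 : (fun x => u (x + (h + k)) - u x) =
      (fun x => u (x + k + h) - u (x + k)) + fun x => u (x + k) - u x := by
    funext x; simp [add_assoc, add_comm k h]
  unfold translationGap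
  rw [h1]
  refine (eLpNorm_add_le (aestronglyMeasurable_comp_add (aestronglyMeasurable_add_sub hu h) k)
    (aestronglyMeasurable_add_sub hu k) hp).trans ?_
  rw [eLpNorm_comp_add (u := fun x => u (x + h) - u x) (aestronglyMeasurable_add_sub hu h) k]

lemma translationGap_neg (hu : AEStronglyMeasurable u μ) (h : E) :
    translationGap μ p u (-h) = translationGap μ p u h := by
  unfold translationGap
  rw [← eLpNorm_comp_add (aestronglyMeasurable_add_sub hu (-h)) h, ← eLpNorm_neg]
  congr 1; funext x; simp

lemma translationGap_nsmul_le (hp : 1 ≤ p) (hu : AEStronglyMeasurable u μ) (h : E) (n : ℕ) :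
    translationGap μ p u (n • h) ≤ n * translationGap μ p u h := by
  induction n with
  | zero => simp
  | succ n ih =>
    rw [succ_nsmul, Nat.cast_succ, add_mul, one_mul]
    exact (translationGap_add_le hp hu _ _).trans (by gcongr)

lemma translationGap_le_of_small [NormedSpace ℝ E] (hp : 1 ≤ p) (hu : AEStronglyMeasurable u μ)
    {r : ℝ} (hr : 0 < r) {c : ℝ≥0∞} (hc : ∀ h, ‖h‖ ≤ r → translationGap μ p u h ≤ c) (h : E) :
    translationGap μ p u h ≤ ENNReal.ofReal (‖h‖ / r + 1) * c := by
  set n : ℕ := ⌊‖h‖ / r⌋₊ + 1 with hn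
  have hn0 : (0 : ℝ) < n := by positivity
  have hlt : ‖h‖ / r < n := by simpa [hn] using Nat.lt_floor_add_one (‖h‖ / r)
  have hle : (n : ℝ) ≤ ‖h‖ / r + 1 := by
    simpa [hn] using Nat.floor_le (show 0 ≤ ‖h‖ / r by positivity)
  have h1 : h = n • ((n : ℝ)⁻¹ • h) := by
    rw [← Nat.cast_smul_eq_nsmul ℝ, smul_smul, mul_inv_cancel₀ hn0.ne', one_smul]
  have h2 : ‖(n : ℝ)⁻¹ • h‖ ≤ r := by
    rw [norm_smul, norm_inv, Real.norm_natCast, inv_mul_le_iff₀ hn0]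
    exact ((div_lt_iff₀ hr).1 hlt).le
  rw [h1]
  refine (translationGap_nsmul_le hp hu _ _).trans ?_
  rw [← h1]
  gcongr
  · rw [← ENNReal.ofReal_natCast]; exact ENNReal.ofReal_le_ofReal hle
  · exact hc _ h2

lemma translationGap_rpow (hp0 : p ≠ 0) (hp : p ≠ ⊤) (h : E) :
    translationGap μ p u h ^ p.toReal = ∫⁻ x, ‖u (x + h) - u x‖ₑ ^ p.toReal ∂μ := by
  rw [translationGap, eLpNorm_eq_lintegral_rpow_enorm_toReal hp0 hp, one_div,
    ENNReal.rpow_inv_rpow (ENNReal.toReal_pos hp0 hp).ne']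

lemma measurable_translationGap_rpow [SFinite μ] [SecondCountableTopology E] (hp0 : p ≠ 0)
    (hp : p ≠ ⊤) (hu : Measurable u) :
    Measurable fun h => translationGap μ p u h ^ p.toReal := by
  simp_rw [translationGap_rpow hp0 hp]
  exact Measurable.lintegral_prod_right' (f := fun z : E × E => ‖u (z.2 + z.1) - u z.2‖ₑ ^ p.toReal)
    (by fun_prop)

lemma translationGap_rpow_mul_measure_le [SFinite μ] [SecondCountableTopology E] (hp1 : 1 ≤ p)
    (hp : p ≠ ⊤) (hu : Measurable u) {B : Set E} (hB : MeasurableSet B) (k : E) :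
    translationGap μ p u k ^ p.toReal * μ {z | z ∈ B ∧ z - k ∈ B} ≤
      2 ^ p.toReal * ∫⁻ z in B, translationGap μ p u z ^ p.toReal ∂μ := by
  have hp0 : p ≠ 0 := (zero_lt_one.trans_le hp1).ne'
  have hq : 1 ≤ p.toReal := by simpa using ENNReal.toReal_mono hp hp1
  set G := fun z => translationGap μ p u z ^ p.toReal with hG
  have hGm : Measurable G := measurable_translationGap_rpow hp0 hp hu
  have hD : MeasurableSet {z | z ∈ B ∧ z - k ∈ B} :=
    hB.inter (measurable_sub_const k hB)
  have hus := hu.aestronglyMeasurable (μ := μ)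
  have hpt : ∀ z, G k ≤ 2 ^ (p.toReal - 1) * (G z + G (z - k)) := by
    intro z
    have h1 : translationGap μ p u k ≤ translationGap μ p u z + translationGap μ p u (z - k) := by
      calc translationGap μ p u k = translationGap μ p u (z + -(z - k)) := by congr 1; abel
        _ ≤ _ := translationGap_add_le hp1 hus _ _
        _ = _ := by rw [translationGap_neg hus]
    exact (ENNReal.rpow_le_rpow h1 (zero_le_one.trans hq)).trans
      (ENNReal.rpow_add_le_mul_rpow_add_rpow _ _ hq)
  calc G k * μ {z | z ∈ B ∧ z - k ∈ B} = ∫⁻ z in {z | z ∈ B ∧ z - k ∈ B}, G k ∂μ := by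
        rw [setLIntegral_const]
    _ ≤ ∫⁻ z in {z | z ∈ B ∧ z - k ∈ B}, 2 ^ (p.toReal - 1) * (G z + G (z - k)) ∂μ :=
        lintegral_mono hpt
    _ = 2 ^ (p.toReal - 1) * (∫⁻ z in {z | z ∈ B ∧ z - k ∈ B}, G z ∂μ +
          ∫⁻ z in {z | z ∈ B ∧ z - k ∈ B}, G (z - k) ∂μ) := by
        rw [lintegral_const_mul _ (by fun_prop), lintegral_add_left hGm]
    _ ≤ 2 ^ (p.toReal - 1) * (∫⁻ z in B, G z ∂μ + ∫⁻ z in B, G z ∂μ) := by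
        refine mul_le_mul' le_rfl (add_le_add (lintegral_mono_set fun z hz => hz.1) ?_)
        rw [← lintegral_indicator hD, ← lintegral_indicator hB,
          ← lintegral_sub_right_eq_self (B.indicator fun z => G z) k]
        refine lintegral_mono fun z => ?_
        by_cases hz : z ∈ {z | z ∈ B ∧ z - k ∈ B}
        · rw [indicator_of_mem hz, indicator_of_mem hz.2]
        · rw [indicator_of_notMem hz]; exact zero_le
    _ = 2 ^ p.toReal * ∫⁻ z in B, G z ∂μ := by
        rw [← two_mul, ← mul_assoc]
        congr 1
        conv_rhs => rw [← sub_add_cancel p.toReal 1,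
          ENNReal.rpow_add _ _ two_ne_zero ENNReal.ofNat_ne_top, ENNReal.rpow_one]

end Translation

section Overlap

variable {E : Type*} [NormedAddCommGroup E] [NormedSpace ℝ E] [FiniteDimensional ℝ E]
  [MeasurableSpace E] [BorelSpace E] {μ : Measure E} [μ.IsAddHaarMeasure]

open scoped Pointwise in
lemma exists_half_measure_le_inter_translate {A : Set E} (hA : IsCompact A) (hA0 : μ A ≠ 0) :
    ∃ r > 0, ∀ h : E, ‖h‖ ≤ r → μ A / 2 ≤ μ {z | z ∈ A ∧ z - h ∈ A} := by
  have ht := tendsto_measure_vadd_sdiff_isCompact_isClosed (μ := μ) hA hA.isClosed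
  have hev := ht.eventually (gt_mem_nhds (ENNReal.half_pos hA0))
  obtain ⟨r, hr, hball⟩ := Metric.eventually_nhds_iff_ball.1 hev
  refine ⟨r / 2, half_pos hr, fun h hh => ?_⟩
  have h1 := hball h (by rw [mem_ball_zero_iff]; linarith)
  have hset : {z | z ∈ A ∧ z - h ∈ A} = A ∩ (h +ᵥ A) := by
    ext z
    simp [mem_vadd_set_iff_neg_vadd_mem, sub_eq_neg_add]
  rw [hset]
  have h2 : μ A ≤ μ (A ∩ (h +ᵥ A)) + μ A / 2 := by
    calc μ A = μ (h +ᵥ A) := (measure_vadd μ h A).symm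
      _ ≤ μ ((h +ᵥ A) ∩ A) + μ ((h +ᵥ A) \ A) := measure_le_inter_add_sdiff _ _ _
      _ ≤ _ := by rw [inter_comm]; gcongr
  have h3 : μ A / 2 + μ A / 2 ≤ μ (A ∩ (h +ᵥ A)) + μ A / 2 := by rwa [ENNReal.add_halves]
  exact (ENNReal.add_le_add_iff_right
    (ENNReal.div_lt_top hA.measure_lt_top.ne two_ne_zero).ne).1 h3

lemma exists_compact_forall_le {K : E → ℝ≥0∞} (hK : AEMeasurable K μ) (hK0 : ¬ K =ᵐ[μ] 0) :
    ∃ (A : Set E) (δ : ℝ≥0∞), IsCompact A ∧ μ A ≠ 0 ∧ δ ≠ 0 ∧ δ ≠ ⊤ ∧ ∀ z ∈ A, δ ≤ K z := by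
  have h1 : ∃ n : ℕ, μ {z | (n : ℝ≥0∞)⁻¹ < K z} ≠ 0 := by
    by_contra! hcon
    refine hK0 (measure_mono_null (fun z hz => ?_) (measure_iUnion_null hcon))
    obtain ⟨n, hn⟩ := ENNReal.exists_inv_nat_lt (show K z ≠ 0 from hz)
    exact mem_iUnion.2 ⟨n, hn⟩
  obtain ⟨n, hn⟩ := h1
  have hnm : NullMeasurableSet {z | (n : ℝ≥0∞)⁻¹ < K z} μ :=
    nullMeasurableSet_lt aemeasurable_const hK
  obtain ⟨t, hts, htm, hte⟩ := hnm.exists_measurable_subset_ae_eq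
  rw [← measure_congr hte] at hn
  obtain ⟨A, hAt, hA, hApos⟩ := htm.exists_lt_isCompact (pos_iff_ne_zero.2 hn)
  have hAK : ∀ z ∈ A, (n : ℝ≥0∞)⁻¹ < K z := fun z hz => hts (hAt hz)
  refine ⟨A, min (n : ℝ≥0∞)⁻¹ 1, hA, hApos.ne', by simp,
    (min_lt_of_right_lt ENNReal.one_lt_top).ne, fun z hz => (min_le_left _ _).trans (hAK z hz).le⟩

end Overlap

section EnergyBound

variable {N : ℕ} {p : ℝ≥0∞} {K : EuclideanSpace ℝ (Fin N) → ℝ≥0∞} {β : ℝ → ℝ}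
  {u : EuclideanSpace ℝ (Fin N) → ℝ}

lemma lintegral_translationGap_le_energy (hp0 : p ≠ 0) (hp : p ≠ ⊤) (hu : Measurable u) {t : ℝ}
    {A : Set (EuclideanSpace ℝ (Fin N))} (hA : MeasurableSet A) {δ : ℝ≥0∞}
    (hδ : ∀ z ∈ A, δ ≤ K z) :
    δ * ENNReal.ofReal (β t) ^ N / phi p K β t *
        ∫⁻ h in {h | β t • h ∈ A}, translationGap volume p u h ^ p.toReal ≤
      energy p (rho p K β t) u := by
  have hq : 0 < p.toReal := ENNReal.toReal_pos hp0 hp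
  set B : Set (EuclideanSpace ℝ (Fin N)) := {h | β t • h ∈ A} with hBdef
  have hB : MeasurableSet B := measurable_const_smul (β t) hA
  set c : ℝ≥0∞ := δ * ENNReal.ofReal (β t) ^ N / phi p K β t with hc
  have hmeas : Measurable fun z : EuclideanSpace ℝ (Fin N) × EuclideanSpace ℝ (Fin N) =>
      B.indicator 1 z.1 * ‖u (z.2 + z.1) - u z.2‖ₑ ^ p.toReal :=
    ((measurable_one.indicator hB).comp measurable_fst).mul (by fun_prop)
  calc c * ∫⁻ h in B, translationGap volume p u h ^ p.toReal
      = c * ∫⁻ h, ∫⁻ y, B.indicator 1 h * ‖u (y + h) - u y‖ₑ ^ p.toReal := by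
        rw [← lintegral_indicator hB]
        congr 1
        refine lintegral_congr fun h => ?_
        rw [lintegral_const_mul _ (by fun_prop), ← translationGap_rpow hp0 hp]
        by_cases hh : h ∈ B <;> simp [hh]
    _ = c * ∫⁻ y, ∫⁻ h, B.indicator 1 h * ‖u (y + h) - u y‖ₑ ^ p.toReal := by
        rw [lintegral_lintegral_swap hmeas.aemeasurable]
    _ ≤ ∫⁻ y, ∫⁻ h, c * (B.indicator 1 h * ‖u (y + h) - u y‖ₑ ^ p.toReal) := by
        refine (lintegral_const_mul_le _ _).trans (lintegral_mono fun y => ?_)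
        exact lintegral_const_mul_le _ _
    _ ≤ ∫⁻ y, ∫⁻ h, ‖u (y + h) - u y‖ₑ ^ p.toReal / ‖(y + h) - y‖ₑ ^ p.toReal *
          rho p K β t ((y + h) - y) := by
        refine lintegral_mono fun y => lintegral_mono fun h => ?_
        simp only [add_sub_cancel_left]
        by_cases hh : h ∈ B
        · rcases eq_or_ne h 0 with rfl | h0
          · simp [hq]
          · have hn0 : ‖h‖ₑ ^ p.toReal ≠ 0 := by simp [h0]
            have hnt : ‖h‖ₑ ^ p.toReal ≠ ⊤ := ENNReal.rpow_ne_top_of_nonneg hq.le enorm_ne_top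
            simp only [indicator_of_mem hh, Pi.one_apply, one_mul]
            rw [rho, mul_comm c, mul_div_assoc, div_eq_mul_inv, mul_assoc, ← mul_assoc _ (‖h‖ₑ ^ _),
              ENNReal.inv_mul_cancel hn0 hnt, one_mul, hc, scaledKernel, mul_comm δ]
            gcongr
            exact hδ _ hh
        · simp [hh]
    _ = energy p (rho p K β t) u := by
        rw [energy]
        refine lintegral_congr fun y => ?_
        exact lintegral_add_left_eq_self (fun x => ‖u x - u y‖ₑ ^ p.toReal / ‖x - y‖ₑ ^ p.toReal *
          rho p K β t (x - y)) y

lemma exists_translationGap_le_of_energy_le (hp1 : 1 ≤ p) (hp : p ≠ ⊤)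
    (hK : AEMeasurable K volume) (hK0 : ¬ K =ᵐ[volume] 0)
    (hKp : ∫⁻ x, ‖x‖ₑ ^ p.toReal * K x < ⊤) {S : ℝ≥0∞} (hS : S ≠ ⊤) :
    ∃ C : ℝ, 0 ≤ C ∧ ∀ (β : ℝ → ℝ) (t : ℝ) (u : EuclideanSpace ℝ (Fin N) → ℝ), 0 < β t →
      Measurable u → energy p (rho p K β t) u ≤ S →
      ∀ h, translationGap volume p u h ≤ ENNReal.ofReal (C * (‖h‖ + (β t)⁻¹)) := by
  have hp0 : p ≠ 0 := (zero_lt_one.trans_le hp1).ne'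
  have hq : 0 < p.toReal := ENNReal.toReal_pos hp0 hp
  obtain ⟨A, δ, hA, hA0, hδ0, hδt, hδ⟩ := exists_compact_forall_le hK hK0
  obtain ⟨r, hr, hrA⟩ := exists_half_measure_le_inter_translate hA hA0
  set M := (∫⁻ x, ‖x‖ₑ ^ p.toReal * K x) + 1 with hM
  have hMt : M ≠ ⊤ := by simp [hM, hKp.ne]
  set D : ℝ≥0∞ := (2 ^ p.toReal * S * M * 2) / (δ * volume A) with hD
  have hDt : D ≠ ⊤ := by
    refine ENNReal.div_ne_top ?_ (mul_ne_zero hδ0 hA0)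
    exact ENNReal.mul_ne_top (ENNReal.mul_ne_top (ENNReal.mul_ne_top
      (ENNReal.rpow_ne_top_of_nonneg hq.le ENNReal.ofNat_ne_top) hS) hMt) ENNReal.ofNat_ne_top
  set c : ℝ≥0∞ := D ^ (p.toReal)⁻¹ with hc
  have hct : c ≠ ⊤ := ENNReal.rpow_ne_top_of_nonneg (inv_nonneg.2 hq.le) hDt
  refine ⟨c.toReal * (r⁻¹ + 1), by positivity, fun β t u hβ hu hE h => ?_⟩
  set b := ENNReal.ofReal (β t) with hb
  have hb0 : b ≠ 0 := by simpa [hb] using hβ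
  have hbt : b ≠ ⊤ := ENNReal.ofReal_ne_top
  have hbp0 : b ^ p.toReal ≠ 0 := by simp [hb0]
  have hbpt : b ^ p.toReal ≠ ⊤ := ENNReal.rpow_ne_top_of_nonneg hq.le hbt
  have hbN0 : b ^ N ≠ 0 := pow_ne_zero _ hb0
  have hbNt : b ^ N ≠ ⊤ := ENNReal.pow_ne_top hbt
  have hphi : phi p K β t ≤ M / b ^ p.toReal := by
    unfold phi moment
    gcongr
    exact (setLIntegral_le_lintegral _ _).trans le_self_add
  have hvol : ∀ T : Set (EuclideanSpace ℝ (Fin N)),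
      volume {z | β t • z ∈ T} = (b ^ N)⁻¹ * volume T := by
    intro T
    have := Measure.addHaar_preimage_smul (volume : Measure (EuclideanSpace ℝ (Fin N))) hβ.ne' T
    rw [finrank_euclideanSpace_fin, abs_of_pos (by positivity),
      ENNReal.ofReal_inv_of_pos (by positivity), ENNReal.ofReal_pow hβ.le] at this
    exact this
  set I := ∫⁻ h in {h | β t • h ∈ A}, translationGap volume p u h ^ p.toReal with hI
  have hlow : δ * b ^ N * b ^ p.toReal / M * I ≤ S := by
    refine le_trans ?_ ((lintegral_translationGap_le_energy hp0 hp hu hA.measurableSet hδ).trans hE)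
    refine mul_le_mul' ?_ le_rfl
    calc δ * b ^ N * b ^ p.toReal / M = δ * b ^ N / (M / b ^ p.toReal) := by
          rw [div_eq_mul_inv, div_eq_mul_inv _ (M / b ^ p.toReal), ENNReal.inv_div (Or.inl hbpt)
            (Or.inl hbp0), div_eq_mul_inv, mul_assoc]
      _ ≤ _ := by gcongr
  have hsmall : ∀ k, ‖k‖ ≤ r / β t → translationGap volume p u k ≤ c / b := by
    intro k hk
    have h1 := translationGap_rpow_mul_measure_le (μ := volume) (B := {z | β t • z ∈ A}) hp1 hp hu
      (measurable_const_smul (β t) hA.measurableSet) k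
    have h2 : {z | z ∈ {z | β t • z ∈ A} ∧ z - k ∈ {z | β t • z ∈ A}} =
        {z | β t • z ∈ {z | z ∈ A ∧ z - β t • k ∈ A}} := by
      ext z; simp [smul_sub]
    rw [h2, hvol, ← hI] at h1
    have h3 : volume A / 2 ≤ volume {z | z ∈ A ∧ z - β t • k ∈ A} := by
      refine hrA _ ?_
      rw [norm_smul, Real.norm_of_nonneg hβ.le, mul_comm]
      exact (le_div_iff₀ hβ).1 hk
    have h4 : translationGap volume p u k ^ p.toReal ≤ D / b ^ p.toReal := by
      have hM0 : M ≠ 0 := by simp [hM]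
      have h5 : δ * b ^ N * b ^ p.toReal * I ≤ S * M := by
        calc δ * b ^ N * b ^ p.toReal * I = δ * b ^ N * b ^ p.toReal / M * I * M := by
              rw [mul_right_comm _ I M, ENNReal.div_mul_cancel hM0 hMt]
          _ ≤ S * M := by gcongr
      have h6 : translationGap volume p u k ^ p.toReal * volume A ≤
          2 ^ p.toReal * I * (2 * b ^ N) := by
        calc translationGap volume p u k ^ p.toReal * volume A
            = translationGap volume p u k ^ p.toReal * ((b ^ N)⁻¹ * (volume A / 2)) *
                (2 * b ^ N) := by
              rw [show translationGap volume p u k ^ p.toReal * ((b ^ N)⁻¹ * (volume A / 2)) *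
                (2 * b ^ N) = translationGap volume p u k ^ p.toReal * ((b ^ N)⁻¹ * b ^ N) *
                (volume A / 2 * 2) by ring, ENNReal.inv_mul_cancel hbN0 hbNt, mul_one,
                ENNReal.div_mul_cancel two_ne_zero ENNReal.ofNat_ne_top]
          _ ≤ 2 ^ p.toReal * I * (2 * b ^ N) := by
              refine mul_le_mul' (le_trans ?_ h1) le_rfl
              gcongr
      rw [ENNReal.le_div_iff_mul_le (Or.inl hbp0) (Or.inl hbpt), hD,
        ENNReal.le_div_iff_mul_le (Or.inl (mul_ne_zero hδ0 hA0))
          (Or.inl (ENNReal.mul_ne_top hδt hA.measure_lt_top.ne))]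
      calc translationGap volume p u k ^ p.toReal * b ^ p.toReal * (δ * volume A)
          = translationGap volume p u k ^ p.toReal * volume A * (b ^ p.toReal * δ) := by ring
        _ ≤ 2 ^ p.toReal * I * (2 * b ^ N) * (b ^ p.toReal * δ) := by gcongr
        _ = 2 ^ p.toReal * (δ * b ^ N * b ^ p.toReal * I) * 2 := by ring
        _ ≤ 2 ^ p.toReal * (S * M) * 2 := by gcongr
        _ = 2 ^ p.toReal * S * M * 2 := by ring
    have h5 := ENNReal.rpow_le_rpow h4 (inv_nonneg.2 hq.le)
    rwa [ENNReal.rpow_rpow_inv hq.ne', ENNReal.div_rpow_of_nonneg _ _ (inv_nonneg.2 hq.le),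
      ENNReal.rpow_rpow_inv hq.ne'] at h5
  have hfin := translationGap_le_of_small hp1 hu.aestronglyMeasurable (div_pos hr hβ) hsmall h
  refine hfin.trans ?_
  rw [← ENNReal.ofReal_toReal hct, hb, ← ENNReal.ofReal_div_of_pos hβ,
    ← ENNReal.ofReal_mul (by positivity), ENNReal.ofReal_toReal hct]
  refine ENNReal.ofReal_le_ofReal ?_
  have : (‖h‖ / (r / β t) + 1) * (c.toReal / β t) = c.toReal * (r⁻¹ * ‖h‖ + (β t)⁻¹) := by
    field_simp
  rw [this, mul_assoc]
  gcongr
  have h6 : 0 ≤ r⁻¹ * (β t)⁻¹ := by positivity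
  have h7 := norm_nonneg h
  nlinarith

end EnergyBound

section Precompact

variable {E : Type*} [NormedAddCommGroup E] [NormedSpace ℝ E] [FiniteDimensional ℝ E]
  [MeasurableSpace E] [BorelSpace E] {μ : Measure E} [μ.IsAddHaarMeasure] {p : ℝ≥0∞}

lemma enorm_average_rpow_le {α : Type*} [MeasurableSpace α] {ν : Measure α} (hp1 : 1 ≤ p)
    (hp : p ≠ ⊤) {f : α → ℝ} (hf : AEStronglyMeasurable f ν) {s : Set α} (hs0 : ν s ≠ 0)
    (hs : ν s ≠ ⊤) :
    ‖⨍ y in s, f y ∂ν‖ₑ ^ p.toReal ≤ (ν s)⁻¹ * ∫⁻ y in s, ‖f y‖ₑ ^ p.toReal ∂ν := by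
  have hp0 : p ≠ 0 := (zero_lt_one.trans_le hp1).ne'
  have hq : 0 < p.toReal := ENNReal.toReal_pos hp0 hp
  set ρ : Measure α := (ν s)⁻¹ • ν.restrict s with hρ
  have hprob : IsProbabilityMeasure ρ := by
    refine ⟨?_⟩
    rw [hρ, Measure.smul_apply, Measure.restrict_apply_univ, smul_eq_mul,
      ENNReal.inv_mul_cancel hs0 hs]
  have h1 : ‖⨍ y in s, f y ∂ν‖ₑ ≤ eLpNorm f p ρ := by
    calc ‖⨍ y in s, f y ∂ν‖ₑ = ‖∫ y, f y ∂ρ‖ₑ := by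
          rw [average, Measure.restrict_apply_univ]
      _ ≤ ∫⁻ y, ‖f y‖ₑ ∂ρ := enorm_integral_le_lintegral_enorm _
      _ = eLpNorm f 1 ρ := (eLpNorm_one_eq_lintegral_enorm).symm
      _ ≤ eLpNorm f p ρ := eLpNorm_le_eLpNorm_of_exponent_le hp1
          ((hf.restrict (s := s)).mono_ac (Measure.smul_absolutelyContinuous))
  refine (ENNReal.rpow_le_rpow h1 hq.le).trans_eq ?_
  rw [eLpNorm_eq_lintegral_rpow_enorm_toReal hp0 hp, one_div, ENNReal.rpow_inv_rpow hq.ne', hρ,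
    lintegral_smul_measure, smul_eq_mul]

lemma eLpNorm_sub_average_le (hp1 : 1 ≤ p) (hp : p ≠ ⊤) {u : E → ℝ} (hu : MemLp u p μ)
    (hum : Measurable u) {δ : ℝ} (hδ : 0 < δ) {F : Set E} (hF : MeasurableSet F) {q : E → E}
    (hq : ∀ x ∈ F, dist (q x) x < δ) {c : ℝ≥0∞}
    (hc : ∀ h, ‖h‖ ≤ 2 * δ → translationGap μ p u h ≤ c) :
    eLpNorm (fun x => u x - ⨍ y in Metric.ball (q x) δ, u y ∂μ) p (μ.restrict F) ≤
      (2 ^ Module.finrank ℝ E) ^ (p.toReal)⁻¹ * c := by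
  have hp0 : p ≠ 0 := (zero_lt_one.trans_le hp1).ne'
  have hpr : 0 < p.toReal := ENNReal.toReal_pos hp0 hp
  have hbt : ∀ x : E, μ (Metric.ball x δ) ≠ ⊤ := fun x => measure_ball_lt_top.ne
  have hb0 : ∀ x : E, μ (Metric.ball x δ) ≠ 0 := fun x => (Metric.measure_ball_pos μ x hδ).ne'
  have hball : ∀ x, μ (Metric.ball x δ) = μ (Metric.ball 0 δ) :=
    fun x => Measure.addHaar_ball_center μ x δ
  have hpt : ∀ x ∈ F, ‖u x - ⨍ y in Metric.ball (q x) δ, u y ∂μ‖ₑ ^ p.toReal ≤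
      (μ (Metric.ball 0 δ))⁻¹ *
        ∫⁻ h in Metric.ball 0 (2 * δ), ‖u (x + h) - u x‖ₑ ^ p.toReal ∂μ := by
    intro x hx
    have hint : IntegrableOn u (Metric.ball (q x) δ) μ := by
      have : IsFiniteMeasure (μ.restrict (Metric.ball (q x) δ)) :=
        ⟨by rw [Measure.restrict_apply_univ]; exact measure_ball_lt_top⟩
      exact (hu.restrict _).integrable hp1
    have h1 : u x - ⨍ y in Metric.ball (q x) δ, u y ∂μ =
        -⨍ y in Metric.ball (q x) δ, (u y - u x) ∂μ := by
      rw [setAverage_eq, setAverage_eq, integral_sub hint (integrableOn_const (hbt _)),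
        setIntegral_const, smul_sub, smul_smul, inv_mul_cancel₀, one_smul]
      · ring
      · exact (ENNReal.toReal_pos (hb0 _) (hbt _)).ne'
    rw [h1, enorm_neg]
    refine (enorm_average_rpow_le hp1 hp (by fun_prop) (hb0 _) (hbt _)).trans ?_
    rw [hball]
    refine mul_le_mul' le_rfl ?_
    rw [← lintegral_indicator measurableSet_ball, ← lintegral_indicator measurableSet_ball,
      ← lintegral_add_left_eq_self _ x]
    refine lintegral_mono fun h => ?_
    by_cases hh : x + h ∈ Metric.ball (q x) δ
    · rw [indicator_of_mem hh, indicator_of_mem]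
      have h2 : dist (x + h) (q x) < δ := hh
      have h3 := hq x hx
      have h4 := dist_triangle (x + h) (q x) x
      rw [mem_ball_zero_iff]
      have h5 : dist (x + h) x = ‖h‖ := by simp [dist_eq_norm]
      linarith
    · rw [indicator_of_notMem hh]; exact zero_le
  have hc' : ∀ h ∈ Metric.ball (0 : E) (2 * δ), translationGap μ p u h ^ p.toReal ≤
      c ^ p.toReal := fun h hh =>
    ENNReal.rpow_le_rpow (hc h (mem_ball_zero_iff.1 hh).le) hpr.le
  rw [eLpNorm_eq_lintegral_rpow_enorm_toReal hp0 hp, one_div]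
  calc (∫⁻ x in F, ‖u x - ⨍ y in Metric.ball (q x) δ, u y ∂μ‖ₑ ^ p.toReal ∂μ) ^ (p.toReal)⁻¹
      ≤ (2 ^ Module.finrank ℝ E * c ^ p.toReal) ^ (p.toReal)⁻¹ := by
        refine ENNReal.rpow_le_rpow ?_ (inv_nonneg.2 hpr.le)
        calc ∫⁻ x in F, ‖u x - ⨍ y in Metric.ball (q x) δ, u y ∂μ‖ₑ ^ p.toReal ∂μ
            ≤ ∫⁻ x in F, (μ (Metric.ball 0 δ))⁻¹ *
                ∫⁻ h in Metric.ball 0 (2 * δ), ‖u (x + h) - u x‖ₑ ^ p.toReal ∂μ ∂μ :=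
              setLIntegral_mono' hF hpt
          _ ≤ ∫⁻ x, (μ (Metric.ball 0 δ))⁻¹ *
                ∫⁻ h in Metric.ball 0 (2 * δ), ‖u (x + h) - u x‖ₑ ^ p.toReal ∂μ ∂μ :=
              setLIntegral_le_lintegral _ _
          _ = (μ (Metric.ball 0 δ))⁻¹ * ∫⁻ x, ∫⁻ h in Metric.ball 0 (2 * δ),
                ‖u (x + h) - u x‖ₑ ^ p.toReal ∂μ ∂μ :=
              lintegral_const_mul' _ _ (ENNReal.inv_ne_top.2 (hb0 _))
          _ = (μ (Metric.ball 0 δ))⁻¹ * ∫⁻ h in Metric.ball 0 (2 * δ),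
                translationGap μ p u h ^ p.toReal ∂μ := by
              rw [lintegral_lintegral_swap (by fun_prop)]
              simp_rw [translationGap_rpow hp0 hp]
          _ ≤ (μ (Metric.ball 0 δ))⁻¹ * ∫⁻ h in Metric.ball 0 (2 * δ), c ^ p.toReal ∂μ := by
              refine mul_le_mul' le_rfl (setLIntegral_mono' measurableSet_ball hc')
          _ = 2 ^ Module.finrank ℝ E * c ^ p.toReal := by
              rw [setLIntegral_const, Measure.addHaar_ball_mul_of_pos μ 0 two_pos,
                ENNReal.ofReal_pow two_pos.le, ENNReal.ofReal_ofNat]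
              rw [show (μ (Metric.ball 0 δ))⁻¹ * (c ^ p.toReal * (2 ^ Module.finrank ℝ E *
                μ (Metric.ball 0 δ))) = (μ (Metric.ball 0 δ))⁻¹ * μ (Metric.ball 0 δ) *
                (2 ^ Module.finrank ℝ E * c ^ p.toReal) by ring,
                ENNReal.inv_mul_cancel (hb0 _) (hbt _), one_mul]
    _ = _ := by
        rw [ENNReal.mul_rpow_of_nonneg _ _ (inv_nonneg.2 hpr.le), ENNReal.rpow_rpow_inv hpr.ne']

lemma exists_simpleFunc_dist_lt {F : Set E} (hF : IsCompact F) {δ : ℝ} (hδ : 0 < δ) :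
    ∃ q : SimpleFunc E E, ∀ x ∈ F, dist (q x) x < δ := by
  obtain ⟨s, hs⟩ := hF.elim_finite_subcover
    (fun n : ℕ => Metric.ball (TopologicalSpace.denseSeq E n) δ) (fun _ => Metric.isOpen_ball)
    (fun x _ => by
      obtain ⟨n, hn⟩ := (TopologicalSpace.denseRange_denseSeq E).exists_dist_lt x hδ
      exact mem_iUnion.2 ⟨n, hn⟩)
  refine ⟨SimpleFunc.nearestPt (TopologicalSpace.denseSeq E) (s.sup id), fun x hx => ?_⟩
  obtain ⟨n, hn, hxn⟩ := mem_iUnion₂.1 (hs hx)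
  have h1 := SimpleFunc.edist_nearestPt_le (TopologicalSpace.denseSeq E) x
    (Finset.le_sup (f := id) hn)
  rw [edist_dist, edist_dist, ENNReal.ofReal_le_ofReal_iff dist_nonneg] at h1
  rw [Metric.mem_ball'] at hxn
  exact h1.trans_lt hxn

open Classical in
/-- The linear map sending a function `c` on the range of a simple function `q` to `c ∘ q`. -/
def simpleComp (q : SimpleFunc E E) (p : ℝ≥0∞) (ν : Measure E) [IsFiniteMeasure ν] :
    (q.range → ℝ) →ₗ[ℝ] Lp ℝ p ν where
  toFun c := ((q.map fun y => if h : y ∈ q.range then c ⟨y, h⟩ else 0).memLp_of_isFiniteMeasure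
    p ν).toLp _
  map_add' c d := by
    rw [← MemLp.toLp_add]
    congr 1; funext x; simp
  map_smul' a c := by
    rw [RingHom.id_apply, ← MemLp.toLp_const_smul]
    congr 1; funext x; simp

lemma coeFn_simpleComp (q : SimpleFunc E E) (ν : Measure E) [IsFiniteMeasure ν] (a : E → ℝ) :
    simpleComp q p ν (fun y => a y) =ᵐ[ν] fun x => a (q x) := by
  refine (MemLp.coeFn_toLp (SimpleFunc.memLp_of_isFiniteMeasure _ p ν)).trans (Eventually.of_forall fun x => ?_)
  simp

lemma locallyPrecompact_range_of_translationGap {N : ℕ} {p : ℝ≥0∞} [Fact (1 ≤ p)] (hp : p ≠ ⊤)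
    (u : ℕ → Lp ℝ p (volume : Measure (EuclideanSpace ℝ (Fin N)))) {R : ℝ}
    (hR : ∀ k, ‖u k‖ ≤ R)
    (hgap : ∀ ε > 0, ∃ δ > 0, ∃ k₀, ∀ k ≥ k₀, ∀ h, ‖h‖ ≤ δ →
      translationGap volume p (u k) h ≤ ENNReal.ofReal ε) :
    LocallyPrecompact p (range u) := by
  intro F hF
  refine (TotallyBounded.closure ?_).isCompact_of_isClosed isClosed_closure
  have hp1 : 1 ≤ p := Fact.out
  have hp0 : p ≠ 0 := (zero_lt_one.trans_le hp1).ne'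
  have hpr : 0 < p.toReal := ENNReal.toReal_pos hp0 hp
  have : IsFiniteMeasure ((volume : Measure (EuclideanSpace ℝ (Fin N))).restrict F) :=
    ⟨by rw [Measure.restrict_apply_univ]; exact hF.measure_lt_top⟩
  set T := LpToLpRestrictCLM (EuclideanSpace ℝ (Fin N)) ℝ ℝ volume p F
  set D : ℝ := ((2 : ℝ) ^ N) ^ (p.toReal)⁻¹
  have hD : 0 < D := by positivity
  rw [Metric.totallyBounded_iff]
  intro ε hε
  obtain ⟨δ', hδ', k₀, hk₀⟩ := hgap (ε / (4 * D)) (by positivity)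
  set δ := δ' / 2
  have hδ : 0 < δ := half_pos hδ'
  obtain ⟨q, hq⟩ := exists_simpleFunc_dist_lt hF hδ
  set a : ℕ → EuclideanSpace ℝ (Fin N) → ℝ := fun k z => ⨍ y in Metric.ball z δ, u k y
  set Φ := simpleComp q p (volume.restrict F)
  have hbdd : ∃ L : ℝ, ∀ k z, ‖a k z‖ ≤ L := by
    set V := volume (Metric.ball (0 : EuclideanSpace ℝ (Fin N)) δ)
    have hV0 : V ≠ 0 := (Metric.measure_ball_pos _ _ hδ).ne'
    have hVt : V ≠ ⊤ := measure_ball_lt_top.ne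
    have hfin : (V⁻¹ * ENNReal.ofReal R ^ p.toReal) ^ (p.toReal)⁻¹ ≠ ⊤ :=
      ENNReal.rpow_ne_top_of_nonneg (inv_nonneg.2 hpr.le) (ENNReal.mul_ne_top
        (ENNReal.inv_ne_top.2 hV0) (ENNReal.rpow_ne_top_of_nonneg hpr.le ENNReal.ofReal_ne_top))
    refine ⟨((V⁻¹ * ENNReal.ofReal R ^ p.toReal) ^ (p.toReal)⁻¹).toReal, fun k z => ?_⟩
    have hVz : volume (Metric.ball z δ) = V := Measure.addHaar_ball_center _ z δ
    have h1 := enorm_average_rpow_le hp1 hp (Lp.aestronglyMeasurable (u k))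
      (s := Metric.ball z δ) (hVz ▸ hV0) (hVz ▸ hVt)
    have h2 : ∫⁻ y in Metric.ball z δ, ‖u k y‖ₑ ^ p.toReal ≤ ENNReal.ofReal R ^ p.toReal := by
      refine (setLIntegral_le_lintegral _ _).trans ?_
      rw [← ENNReal.rpow_inv_rpow hpr.ne' (∫⁻ y, ‖u k y‖ₑ ^ p.toReal), ← one_div,
        ← eLpNorm_eq_lintegral_rpow_enorm_toReal hp0 hp]
      refine ENNReal.rpow_le_rpow ?_ hpr.le
      rw [← Lp.enorm_def, ← ofReal_norm]
      exact ENNReal.ofReal_le_ofReal (hR k)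
    rw [hVz] at h1
    have h3 := ENNReal.rpow_le_rpow (h1.trans (mul_le_mul' le_rfl h2)) (inv_nonneg.2 hpr.le)
    rw [ENNReal.rpow_rpow_inv hpr.ne'] at h3
    rw [← toReal_enorm]
    exact ENNReal.toReal_mono hfin h3
  obtain ⟨L, hL⟩ := hbdd
  have htb : TotallyBounded (Φ '' Metric.closedBall 0 L) :=
    ((isCompact_closedBall 0 L).image (LinearMap.continuous_of_finiteDimensional Φ)).totallyBounded
  obtain ⟨s, hs, hcov⟩ := Metric.totallyBounded_iff.1 htb (ε / 2) (half_pos hε)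
  refine ⟨s ∪ (fun k => T (u k)) '' Iio k₀, hs.union ((finite_Iio k₀).image _), ?_⟩
  rintro _ ⟨_, ⟨k, rfl⟩, rfl⟩
  rcases lt_or_ge k k₀ with hk | hk
  · exact mem_iUnion₂.2 ⟨T (u k), Or.inr ⟨k, hk, rfl⟩, Metric.mem_ball_self hε⟩
  have hmem : Φ (fun y => a k y) ∈ Φ '' Metric.closedBall 0 L := by
    refine ⟨_, ?_, rfl⟩
    have hL0 : 0 ≤ L := (norm_nonneg _).trans (hL 0 0)
    rw [mem_closedBall_zero_iff, pi_norm_le_iff_of_nonneg hL0]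
    exact fun y => hL k y
  obtain ⟨g, hg, hgd⟩ := mem_iUnion₂.1 (hcov hmem)
  refine mem_iUnion₂.2 ⟨g, Or.inl hg, ?_⟩
  have hclose : dist (T (u k)) (Φ (fun y => a k y)) ≤ ε / 4 := by
    have h1 := eLpNorm_sub_average_le hp1 hp (Lp.memLp (u k)) (Lp.stronglyMeasurable (u k)).measurable
      hδ hF.measurableSet hq (c := ENNReal.ofReal (ε / (4 * D)))
      (fun h hh => hk₀ k hk h (by simpa [δ, mul_div_cancel₀] using hh))
    rw [Lp.dist_def]
    refine ENNReal.toReal_le_of_le_ofReal (by positivity) ?_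
    calc eLpNorm (⇑(T (u k)) - ⇑(Φ fun y => a k y)) p (volume.restrict F)
        = eLpNorm (fun x => u k x - a k (q x)) p (volume.restrict F) := by
          refine eLpNorm_congr_ae ?_
          filter_upwards [LpToLpRestrictCLM_coeFn ℝ F (u k),
            coeFn_simpleComp (p := p) q (volume.restrict F) (a k)] with x h2 h3
          rw [Pi.sub_apply, h2, h3]
      _ ≤ _ := h1
      _ = ENNReal.ofReal (D * (ε / (4 * D))) := by
          rw [finrank_euclideanSpace_fin, ENNReal.ofReal_mul hD.le,
            ← ENNReal.ofReal_rpow_of_pos (by positivity), ENNReal.ofReal_pow two_pos.le,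
            ENNReal.ofReal_ofNat]
      _ = ENNReal.ofReal (ε / 4) := by congr 1; field_simp
  rw [Metric.mem_ball] at hgd ⊢
  have := dist_triangle (T (u k)) (Φ fun y => a k y) g
  linarith

end Precompact

section WeakLimit

open scoped CompactlySupported

variable {E : Type*} [NormedAddCommGroup E] [NormedSpace ℝ E] [FiniteDimensional ℝ E]
  [MeasurableSpace E] [BorelSpace E] {μ : Measure E} [μ.IsAddHaarMeasure] {p q : ℝ≥0∞}

lemma enorm_integral_mul_le {α : Type*} [MeasurableSpace α] {μ : Measure α} [p.HolderConjugate q]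
    {f g : α → ℝ} (hf : AEStronglyMeasurable f μ) (hg : AEStronglyMeasurable g μ) :
    ‖∫ x, f x * g x ∂μ‖ₑ ≤ eLpNorm g p μ * eLpNorm f q μ := by
  have : q.HolderConjugate p := ENNReal.HolderConjugate.symm
  calc ‖∫ x, f x * g x ∂μ‖ₑ ≤ ∫⁻ x, ‖f x * g x‖ₑ ∂μ := enorm_integral_le_lintegral_enorm _
    _ = eLpNorm (f • g) 1 μ := by rw [eLpNorm_one_eq_lintegral_enorm]; rfl
    _ ≤ eLpNorm f q μ * eLpNorm g p μ := eLpNorm_smul_le_mul_eLpNorm hg hf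
    _ = _ := mul_comm _ _

lemma compactlySupported_memLp (f : C_c(E, ℝ)) (q : ℝ≥0∞) : MemLp f q μ :=
  f.continuous.memLp_of_hasCompactSupport f.hasCompactSupport

lemma compactlySupported_mul_integrable [p.HolderConjugate q] {g : E → ℝ} (hg : MemLp g p μ)
    (f : C_c(E, ℝ)) : Integrable (fun x => f x * g x) μ := by
  have : q.HolderConjugate p := ENNReal.HolderConjugate.symm
  exact (compactlySupported_memLp f q).integrable_mul hg

/-- A bounded sequence of nonnegative functions in `L^p` has a weak-* limit, as a Radon measure,
along any ultrafilter. -/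
lemma exists_measure_tendsto_integral [p.HolderConjugate q] (U : Ultrafilter ℕ) {D : ℕ → E → ℝ}
    (hD0 : ∀ n x, 0 ≤ D n x) (hD : ∀ n, MemLp (D n) p μ) {C : ℝ≥0∞} (hC : C ≠ ⊤)
    (hDC : ∀ n, eLpNorm (D n) p μ ≤ C) :
    ∃ ν : Measure E, ν.Regular ∧
      (∀ f : C_c(E, ℝ), Tendsto (fun n => ∫ x, f x * D n x ∂μ) U (𝓝 (∫ x, f x ∂ν))) ∧
      ∀ f : C_c(E, ℝ), ∫⁻ x, ENNReal.ofReal (f x) ∂ν ≤ C * eLpNorm f q μ := by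
  have hint : ∀ (f : C_c(E, ℝ)) n, Integrable (fun x => f x * D n x) μ := fun f n =>
    compactlySupported_mul_integrable (q := q) (hD n) f
  have hbd : ∀ (f : C_c(E, ℝ)) n, ‖∫ x, f x * D n x ∂μ‖ₑ ≤ C * eLpNorm f q μ := fun f n =>
    (enorm_integral_mul_le (compactlySupported_memLp f q).1 (hD n).1).trans
      (mul_le_mul' (hDC n) le_rfl)
  have hfin : ∀ f : C_c(E, ℝ), C * eLpNorm f q μ ≠ ⊤ := fun f =>
    ENNReal.mul_ne_top hC (compactlySupported_memLp f q).2.ne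
  have hlim : ∀ f : C_c(E, ℝ), ∃ l : ℝ, l ≤ (C * eLpNorm f q μ).toReal ∧
      Tendsto (fun n => ∫ x, f x * D n x ∂μ) U (𝓝 l) := by
    intro f
    set M := (C * eLpNorm f q μ).toReal
    have hmem : ∀ n, ∫ x, f x * D n x ∂μ ∈ Icc (-M) M := by
      intro n
      rw [mem_Icc, ← abs_le, ← Real.norm_eq_abs, ← toReal_enorm]
      exact ENNReal.toReal_mono (hfin f) (hbd f n)
    obtain ⟨l, hl, hle⟩ := (isCompact_Icc (a := -M) (b := M)).ultrafilter_le_nhds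
      (U.map fun n => ∫ x, f x * D n x ∂μ)
      (le_principal_iff.2 (Ultrafilter.mem_map.2 (univ_mem' hmem)))
    exact ⟨l, hl.2, hle⟩
  choose Λ hΛM hΛ using hlim
  let L : C_c(E, ℝ) →ₚ[ℝ] ℝ := PositiveLinearMap.mk₀
    { toFun := Λ
      map_add' := fun f g => tendsto_nhds_unique (hΛ (f + g)) (by
        refine ((hΛ f).add (hΛ g)).congr fun n => ?_
        rw [← integral_add (hint f n) (hint g n)]
        refine integral_congr_ae (Eventually.of_forall fun x => ?_)
        simp [add_mul])
      map_smul' := fun c f => tendsto_nhds_unique (hΛ (c • f)) (by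
        refine ((hΛ f).const_mul c).congr fun n => ?_
        rw [← integral_const_mul]
        refine integral_congr_ae (Eventually.of_forall fun x => ?_)
        simp [mul_assoc]) }
    (fun f hf => ge_of_tendsto' (hΛ f) fun n =>
      integral_nonneg fun x => mul_nonneg (hf x) (hD0 n x))
  have hL : ∀ f, L f = Λ f := fun f => rfl
  refine ⟨RealRMK.rieszMeasure L, inferInstance, fun f => ?_, fun f => ?_⟩
  · rw [RealRMK.integral_rieszMeasure, hL]
    exact hΛ f
  · let f' : C_c(E, ℝ) := ⟨⟨fun x => max (f x) 0, f.continuous.max continuous_const⟩,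
      f.hasCompactSupport.comp_left (g := fun y => max y 0) (max_self 0)⟩
    have hf' : ∀ x, f' x = max (f x) 0 := fun x => rfl
    have h1 : ∫⁻ x, ENNReal.ofReal (f x) ∂(RealRMK.rieszMeasure L) = ENNReal.ofReal (Λ f') := by
      rw [← hL, ← RealRMK.integral_rieszMeasure L f', ofReal_integral_eq_lintegral_ofReal
        f'.integrable (Eventually.of_forall fun x => le_max_right _ _)]
      refine lintegral_congr fun x => ?_
      rw [hf', ENNReal.ofReal_max]; simp
    rw [h1]
    calc ENNReal.ofReal (Λ f') ≤ C * eLpNorm f' q μ :=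
          ENNReal.ofReal_le_of_le_toReal (hΛM f')
      _ ≤ C * eLpNorm f q μ := by
          refine mul_le_mul' le_rfl (eLpNorm_mono fun x => ?_)
          rw [hf', Real.norm_eq_abs, Real.norm_eq_abs, abs_of_nonneg (le_max_right _ _)]
          exact max_le (le_abs_self _) (abs_nonneg _)

lemma measure_le_of_compact_of_lintegral_le {ν : Measure E} {C : ℝ≥0∞}
    (hν : ∀ f : C_c(E, ℝ), ∫⁻ x, ENNReal.ofReal (f x) ∂ν ≤ C * eLpNorm f q μ)
    {K O : Set E} (hK : IsCompact K) (hO : IsOpen O) (hKO : K ⊆ O) :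
    ν K ≤ C * eLpNorm (O.indicator fun _ => (1 : ℝ)) q μ := by
  obtain ⟨f, hf1, hfc, hfO, hf01⟩ := exists_continuousMap_one_of_isCompact_subset_isOpen hK hO hKO
  calc ν K = ∫⁻ x in K, 1 ∂ν := by simp
    _ ≤ ∫⁻ x in K, ENNReal.ofReal (f x) ∂ν := by
        refine setLIntegral_mono' hK.measurableSet fun x hx => ?_
        simp [hf1 hx]
    _ ≤ ∫⁻ x, ENNReal.ofReal (f x) ∂ν := setLIntegral_le_lintegral _ _
    _ ≤ C * eLpNorm f q μ := hν ⟨f, hfc⟩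
    _ ≤ _ := by
        refine mul_le_mul' le_rfl (eLpNorm_mono fun x => ?_)
        by_cases hx : x ∈ O
        · rw [indicator_of_mem hx, Real.norm_of_nonneg (hf01 x).1]
          simpa using (hf01 x).2
        · have : f x = 0 := image_eq_zero_of_notMem_tsupport fun h => hx (hfO h)
          simp [this]

lemma isFiniteMeasure_of_lintegral_le {ν : Measure E} [ν.Regular] {C : ℝ≥0∞} (hC : C ≠ ⊤)
    (hν : ∀ f : C_c(E, ℝ), ∫⁻ x, ENNReal.ofReal (f x) ∂ν ≤ C * eLpNorm f ⊤ μ) :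
    IsFiniteMeasure ν := by
  refine ⟨lt_of_le_of_lt ?_ hC.lt_top⟩
  rw [isOpen_univ.measure_eq_iSup_isCompact]
  refine iSup₂_le fun K _ => iSup_le fun hK => ?_
  refine (measure_le_of_compact_of_lintegral_le hν hK isOpen_univ (subset_univ K)).trans ?_
  calc C * eLpNorm (univ.indicator fun _ => (1 : ℝ)) ⊤ μ ≤ C * 1 := by
        refine mul_le_mul' le_rfl ?_
        rw [eLpNorm_exponent_top]
        exact eLpNormEssSup_le_of_ae_enorm_bound (by simp)
    _ = C := mul_one C

lemma absolutelyContinuous_of_lintegral_le {ν : Measure E} [ν.Regular] {C : ℝ≥0∞} (hC : C ≠ ⊤)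
    (hq0 : q ≠ 0) (hq : q ≠ ⊤)
    (hν : ∀ f : C_c(E, ℝ), ∫⁻ x, ENNReal.ofReal (f x) ∂ν ≤ C * eLpNorm f q μ) :
    ν ≪ μ := by
  have hqr : 0 < q.toReal := ENNReal.toReal_pos hq0 hq
  refine Measure.AbsolutelyContinuous.mk fun s hs hs0 => ?_
  rw [hs.measure_eq_iSup_isCompact]
  refine le_antisymm (iSup₂_le fun K hKs => iSup_le fun hK => ?_) zero_le
  have ht : Tendsto (fun ε : ℝ≥0∞ => C * ε ^ (1 / q.toReal)) (𝓝[>] 0) (𝓝 0) := by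
    have h1 : Tendsto (fun ε : ℝ≥0∞ => ε ^ (1 / q.toReal)) (𝓝 0) (𝓝 0) := by
      have := (ENNReal.continuous_rpow_const (y := 1 / q.toReal)).tendsto 0
      rwa [ENNReal.zero_rpow_of_pos (by positivity)] at this
    have h2 := ENNReal.Tendsto.const_mul h1 (Or.inr hC)
    rw [mul_zero] at h2
    exact h2.mono_left nhdsWithin_le_nhds
  refine ge_of_tendsto ht (eventually_mem_nhdsWithin.mono fun ε hε => ?_)
  have hK0 : μ K < ε := by rw [measure_mono_null hKs hs0]; exact hε
  obtain ⟨O, hKO, hO, hOε⟩ := K.exists_isOpen_lt_of_lt ε hK0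
  refine (measure_le_of_compact_of_lintegral_le hν hK hO hKO).trans ?_
  rw [eLpNorm_indicator_const hO.measurableSet hq0 hq]
  simp only [enorm_one, one_mul]
  gcongr

lemma lintegral_mul_le_of_compactlySupported {g : E → ℝ≥0∞} (hg : Measurable g) {C : ℝ≥0∞}
    (hC : C ≠ ⊤) (hq0 : q ≠ 0) (hq1 : 1 ≤ q) (hq : q ≠ ⊤)
    (hgC : ∀ f : C_c(E, ℝ), ∫⁻ x, ENNReal.ofReal (f x) * g x ∂μ ≤ C * eLpNorm f q μ)
    {h : E → ℝ} (hh : MemLp h q μ) :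
    ∫⁻ x, ENNReal.ofReal (h x) * g x ∂μ ≤ C * eLpNorm h q μ := by
  have hex : ∀ n : ℕ, ∃ f : C_c(E, ℝ), eLpNorm (h - ⇑f) q μ ≤ (n : ℝ≥0∞)⁻¹ := by
    intro n
    obtain ⟨f, hfc, hfn, hfcont, -⟩ := hh.exists_hasCompactSupport_eLpNorm_sub_le hq
      (ENNReal.inv_ne_zero.2 (ENNReal.natCast_ne_top n))
    exact ⟨⟨⟨f, hfcont⟩, hfc⟩, hfn⟩
  choose f hf using hex
  have hlim : Tendsto (fun n => eLpNorm (⇑(f n) - h) q μ) atTop (𝓝 0) := by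
    refine tendsto_of_tendsto_of_tendsto_of_le_of_le tendsto_const_nhds
      ENNReal.tendsto_inv_nat_nhds_zero (fun _ => zero_le) fun n => ?_
    rw [eLpNorm_sub_comm]; exact hf n
  obtain ⟨ns, hns, hae⟩ := (tendstoInMeasure_of_tendsto_eLpNorm hq0
    (fun n => (compactlySupported_memLp (f n) q).1) hh.1 hlim).exists_seq_tendsto_ae
  have hlim' : Tendsto (fun k => C * (eLpNorm h q μ + eLpNorm (⇑(f (ns k)) - h) q μ)) atTop
      (𝓝 (C * (eLpNorm h q μ + 0))) :=
    ENNReal.Tendsto.const_mul (tendsto_const_nhds.add (hlim.comp hns.tendsto_atTop)) (Or.inr hC)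
  rw [add_zero] at hlim'
  calc ∫⁻ x, ENNReal.ofReal (h x) * g x ∂μ
      ≤ ∫⁻ x, liminf (fun k => ENNReal.ofReal (f (ns k) x) * g x) atTop ∂μ := by
        refine lintegral_mono_ae ?_
        filter_upwards [hae] with x hx
        rcases eq_or_ne (ENNReal.ofReal (h x)) 0 with h0 | h0
        · simp [h0]
        · exact (ENNReal.Tendsto.mul_const ((ENNReal.continuous_ofReal.tendsto _).comp hx)
            (Or.inl h0)).liminf_eq.ge
    _ ≤ liminf (fun k => ∫⁻ x, ENNReal.ofReal (f (ns k) x) * g x ∂μ) atTop :=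
        lintegral_liminf_le fun k => ((f (ns k)).continuous.measurable.ennreal_ofReal).mul hg
    _ ≤ liminf (fun k => C * (eLpNorm h q μ + eLpNorm (⇑(f (ns k)) - h) q μ)) atTop := by
        refine liminf_le_liminf (Eventually.of_forall fun k => (hgC _).trans ?_)
        refine mul_le_mul' le_rfl ?_
        have := eLpNorm_add_le hh.1 ((compactlySupported_memLp (μ := μ) (f (ns k)) q).1.sub hh.1) hq1
        simpa using this
    _ = C * eLpNorm h q μ := hlim'.liminf_eq

lemma lintegral_rpow_le_of_compactlySupported [hpq : p.HolderConjugate q] (hp : p ≠ ⊤)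
    (hq : q ≠ ⊤) {g : E → ℝ≥0∞} (hg : Measurable g) {C : ℝ≥0∞} (hC : C ≠ ⊤)
    (hgC : ∀ f : C_c(E, ℝ), ∫⁻ x, ENNReal.ofReal (f x) * g x ∂μ ≤ C * eLpNorm f q μ) :
    ∫⁻ x, g x ^ p.toReal ∂μ ≤ C ^ p.toReal := by
  have hpq' := ENNReal.HolderConjugate.toReal_of_ne_top hp hq
  have hp0 := hpq'.pos
  have hq0 := hpq'.symm.pos
  have hqE0 : q ≠ 0 := fun h => by simp [h] at hq0
  have hq1 : 1 ≤ q := hpq.symm.one_le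
  set G : ℕ → E → ℝ≥0∞ := fun n => (Metric.ball 0 n).indicator fun x => min (g x) n with hG
  have hGm : ∀ n, Measurable (G n) := fun n => (hg.min measurable_const).indicator measurableSet_ball
  have hGg : ∀ n x, G n x ≤ g x := fun n x => indicator_le (fun _ _ => min_le_left _ _) x
  have hGn : ∀ n x, G n x ≤ n := fun n x => indicator_le (fun _ _ => min_le_right _ _) x
  have hbound : ∀ n, ∫⁻ x, G n x ^ p.toReal ∂μ ≤ C ^ p.toReal := by
    intro n
    set a := ∫⁻ x, G n x ^ p.toReal ∂μ with ha
    have hGt : ∀ x, G n x ^ (p.toReal - 1) ≠ ⊤ := fun x =>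
      ENNReal.rpow_ne_top_of_nonneg hpq'.sub_one_pos.le ((hGn n x).trans_lt
        (ENNReal.natCast_lt_top n)).ne
    set h : E → ℝ := fun x => (G n x ^ (p.toReal - 1)).toReal with hh
    have hhof : ∀ x, ENNReal.ofReal (h x) = G n x ^ (p.toReal - 1) := fun x =>
      ENNReal.ofReal_toReal (hGt x)
    have hafin : a ≠ ⊤ := by
      refine ne_top_of_le_ne_top (b := (n : ℝ≥0∞) ^ p.toReal * μ (Metric.ball 0 n)) ?_ ?_
      · exact ENNReal.mul_ne_top (ENNReal.rpow_ne_top_of_nonneg hp0.le (ENNReal.natCast_ne_top n))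
          measure_ball_lt_top.ne
      · rw [← setLIntegral_const, ← lintegral_indicator measurableSet_ball]
        refine lintegral_mono fun x => ?_
        by_cases hx : x ∈ Metric.ball (0 : E) n
        · rw [indicator_of_mem hx]
          exact ENNReal.rpow_le_rpow (hGn n x) hp0.le
        · simp [hG, hx, hp0]
    have hnorm : eLpNorm h q μ = a ^ (1 / q.toReal) := by
      rw [eLpNorm_eq_lintegral_rpow_enorm_toReal hqE0 hq, ha]
      congr 1
      refine lintegral_congr fun x => ?_
      rw [Real.enorm_eq_ofReal ENNReal.toReal_nonneg, hhof, ← ENNReal.rpow_mul,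
        hpq'.sub_one_mul_conj]
    have hmem : MemLp h q μ :=
      ⟨((hGm n).pow_const _).ennreal_toReal.aestronglyMeasurable, by
        rw [hnorm]
        exact ENNReal.rpow_lt_top_of_nonneg (by positivity) hafin⟩
    have h1 : a ≤ C * a ^ (1 / q.toReal) := by
      calc a ≤ ∫⁻ x, ENNReal.ofReal (h x) * g x ∂μ := by
            refine lintegral_mono fun x => ?_
            rw [hhof]
            calc G n x ^ p.toReal = G n x ^ (p.toReal - 1 + 1) := by rw [sub_add_cancel]
              _ = G n x ^ (p.toReal - 1) * G n x := by
                rw [ENNReal.rpow_add_of_nonneg _ _ hpq'.sub_one_pos.le zero_le_one,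
                  ENNReal.rpow_one]
              _ ≤ _ := by gcongr; exact hGg n x
        _ ≤ C * eLpNorm h q μ := lintegral_mul_le_of_compactlySupported hg hC hqE0 hq1 hq hgC hmem
        _ = _ := by rw [hnorm]
    rcases eq_or_ne a 0 with h0 | h0
    · rw [h0]; exact zero_le
    have h2 : a ^ (1 / p.toReal) ≤ C := by
      have h3 : a = a ^ (1 / p.toReal) * a ^ (1 / q.toReal) := by
        rw [← ENNReal.rpow_add _ _ h0 hafin, one_div, one_div, hpq'.inv_add_inv_eq_one,
          ENNReal.rpow_one]
      rw [h3, ← h3] at h1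
      refine (ENNReal.mul_le_mul_iff_left (c := a ^ (1 / q.toReal)) ?_ ?_).1 (h3.symm.le.trans h1)
      · simp [h0, hafin]
      · exact ENNReal.rpow_ne_top_of_nonneg (by positivity) hafin
    calc a = (a ^ (1 / p.toReal)) ^ p.toReal := by
          rw [one_div, ENNReal.rpow_inv_rpow hp0.ne']
      _ ≤ _ := ENNReal.rpow_le_rpow h2 hp0.le
  have hGlim : ∀ x, Tendsto (fun n => G n x) atTop (𝓝 (g x)) := by
    intro x
    have h1 : Tendsto (fun n : ℕ => min (g x) n) atTop (𝓝 (min (g x) ⊤)) :=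
      tendsto_const_nhds.min ENNReal.tendsto_nat_nhds_top
    rw [min_eq_left le_top] at h1
    refine h1.congr' ?_
    obtain ⟨m, hm⟩ := exists_nat_gt ‖x‖
    filter_upwards [eventually_ge_atTop m] with n hn
    have : x ∈ Metric.ball (0 : E) n := by
      rw [mem_ball_zero_iff]; exact hm.trans_le (by exact_mod_cast hn)
    simp [hG, this]
  calc ∫⁻ x, g x ^ p.toReal ∂μ = ∫⁻ x, liminf (fun n => G n x ^ p.toReal) atTop ∂μ := by
        refine lintegral_congr fun x => ?_
        exact (((ENNReal.continuous_rpow_const (y := p.toReal)).tendsto _).comp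
          (hGlim x)).liminf_eq.symm
    _ ≤ liminf (fun n => ∫⁻ x, G n x ^ p.toReal ∂μ) atTop :=
        lintegral_liminf_le fun n => (hGm n).pow_const _
    _ ≤ C ^ p.toReal := by
        refine (liminf_le_liminf (Eventually.of_forall hbound)).trans_eq ?_
        exact liminf_const _

lemma exists_memLp_integral_eq [hpq : p.HolderConjugate q] (hp : p ≠ ⊤) (hq : q ≠ ⊤)
    {ν : Measure E} [ν.Regular] {C : ℝ≥0∞} (hC : C ≠ ⊤)
    (hν : ∀ f : C_c(E, ℝ), ∫⁻ x, ENNReal.ofReal (f x) ∂ν ≤ C * eLpNorm f q μ) :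
    ∃ g : E → ℝ, MemLp g p μ ∧ ∀ φ : E → ℝ, ∫ x, φ x ∂ν = ∫ x, g x * φ x ∂μ := by
  have hq0 : q ≠ 0 := (zero_lt_one.trans_le hpq.symm.one_le).ne'
  have hp0 : p ≠ 0 := (zero_lt_one.trans_le hpq.one_le).ne'
  have hac : ν ≪ μ := absolutelyContinuous_of_lintegral_le hC hq0 hq hν
  have hwd : μ.withDensity (ν.rnDeriv μ) = ν := Measure.withDensity_rnDeriv_eq ν μ hac
  have hm := Measure.measurable_rnDeriv ν μ
  refine ⟨fun x => (ν.rnDeriv μ x).toReal, ⟨hm.ennreal_toReal.aestronglyMeasurable, ?_⟩, fun φ => ?_⟩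
  · have h1 : ∫⁻ x, ν.rnDeriv μ x ^ p.toReal ∂μ ≤ C ^ p.toReal := by
      refine lintegral_rpow_le_of_compactlySupported hp hq hm hC fun f => ?_
      refine le_trans (le_of_eq ?_) (hν f)
      conv_rhs => rw [← hwd]
      rw [lintegral_withDensity_eq_lintegral_mul _ hm (g := fun x => ENNReal.ofReal (f x))
        f.continuous.measurable.ennreal_ofReal]
      simp [mul_comm]
    rw [eLpNorm_lt_top_iff_lintegral_rpow_enorm_lt_top hp0 hp]
    refine lt_of_le_of_lt (lintegral_mono fun x => ?_) (h1.trans_lt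
      (ENNReal.rpow_lt_top_of_nonneg ENNReal.toReal_nonneg hC))
    rw [Real.enorm_eq_ofReal ENNReal.toReal_nonneg]
    exact ENNReal.rpow_le_rpow ENNReal.ofReal_toReal_le ENNReal.toReal_nonneg
  · conv_lhs => rw [← hwd]
    rw [integral_withDensity_eq_integral_toReal_smul hm (Measure.rnDeriv_lt_top ν μ)]
    rfl

end WeakLimit

section LocalLimit

variable {N : ℕ} {p : ℝ≥0∞} {v : EuclideanSpace ℝ (Fin N) → ℝ}

lemma eLpNorm_le_of_forall_closedBall {E : Type*} [NormedAddCommGroup E] [MeasurableSpace E]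
    [BorelSpace E] {μ : Measure E} {f : E → ℝ} (hf : AEStronglyMeasurable f μ) {c : ℝ≥0∞}
    (hc : ∀ n : ℕ, eLpNorm f p (μ.restrict (Metric.closedBall 0 n)) ≤ c) : eLpNorm f p μ ≤ c := by
  have hm : ∀ n : ℕ, MeasurableSet (Metric.closedBall (0 : E) n) := fun n =>
    Metric.isClosed_closedBall.measurableSet
  refine (Lp.eLpNorm_lim_le_liminf_eLpNorm (f := fun n : ℕ => (Metric.closedBall 0 n).indicator f)
    (fun n => hf.indicator (hm n)) f (Eventually.of_forall fun x => ?_)).trans ?_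
  · refine tendsto_const_nhds.congr' ?_
    obtain ⟨m, hm⟩ := exists_nat_ge ‖x‖
    filter_upwards [eventually_ge_atTop m] with n hn
    rw [indicator_of_mem]
    rw [mem_closedBall_zero_iff]
    exact hm.trans (by exact_mod_cast hn)
  · refine (liminf_le_liminf (Eventually.of_forall fun n => ?_)).trans_eq (liminf_const c)
    rw [eLpNorm_indicator_eq_eLpNorm_restrict (hm n)]
    exact hc n

lemma MemLpLoc.aestronglyMeasurable (hv : MemLpLoc p v) : AEStronglyMeasurable v volume := by
  have h1 : (⋃ n : ℕ, Metric.closedBall (0 : EuclideanSpace ℝ (Fin N)) n) = univ :=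
    Metric.iUnion_closedBall_nat 0
  rw [← Measure.restrict_univ (μ := volume), ← h1, aestronglyMeasurable_iUnion_iff]
  exact fun n => (hv _ (isCompact_closedBall _ _)).1

variable {w : ℕ → EuclideanSpace ℝ (Fin N) → ℝ}

lemma TendstoLpLoc.eLpNorm_le (hp1 : 1 ≤ p) (hv : MemLpLoc p v)
    (hw : ∀ j, AEStronglyMeasurable (w j) volume) (h : TendstoLpLoc p w v) {c : ℝ≥0∞}
    (hc : ∀ j, eLpNorm (w j) p volume ≤ c) : eLpNorm v p volume ≤ c := by
  have hvm := hv.aestronglyMeasurable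
  refine eLpNorm_le_of_forall_closedBall hvm fun n => ?_
  have ht := (h _ (isCompact_closedBall 0 (n : ℝ))).add_const c
  rw [zero_add] at ht
  refine ge_of_tendsto' ht fun j => ?_
  have h1 : v = (fun x => -(w j x - v x)) + w j := by funext x; simp
  calc eLpNorm v p (volume.restrict (Metric.closedBall 0 n))
      ≤ eLpNorm (fun x => -(w j x - v x)) p (volume.restrict (Metric.closedBall 0 n)) +
        eLpNorm (w j) p (volume.restrict (Metric.closedBall 0 n)) := by
        conv_lhs => rw [h1]
        exact eLpNorm_add_le ((hw j).sub hvm).neg.restrict (hw j).restrict hp1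
    _ ≤ _ := by
        refine add_le_add (eLpNorm_neg _ _ _).le ((eLpNorm_restrict_le _ _ _ _).trans (hc j))

lemma TendstoLpLoc.translationGap_le (hp1 : 1 ≤ p) (hv : MemLpLoc p v)
    (hw : ∀ j, AEStronglyMeasurable (w j) volume) (h : TendstoLpLoc p w v)
    (k : EuclideanSpace ℝ (Fin N)) {c : ℕ → ℝ≥0∞} {l : ℝ≥0∞} (hcl : Tendsto c atTop (𝓝 l))
    (hc : ∀ j, translationGap volume p (w j) k ≤ c j) : translationGap volume p v k ≤ l := by
  have hvm := hv.aestronglyMeasurable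
  refine eLpNorm_le_of_forall_closedBall (aestronglyMeasurable_add_sub hvm k) fun n => ?_
  set B := Metric.closedBall (0 : EuclideanSpace ℝ (Fin N)) n
  set B' := Metric.closedBall (0 : EuclideanSpace ℝ (Fin N)) (n + ‖k‖)
  have ht := ((h B' (isCompact_closedBall _ _)).add hcl).add (h B (isCompact_closedBall _ _))
  rw [zero_add, add_zero] at ht
  refine ge_of_tendsto' ht fun j => ?_
  have hsub : AEStronglyMeasurable (fun x => w j x - v x) volume := (hw j).sub hvm
  have h1 : (fun x => v (x + k) - v x) = ((fun x => -(w j (x + k) - v (x + k))) +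
      fun x => w j (x + k) - w j x) + fun x => w j x - v x := by
    funext x; simp only [Pi.add_apply]; ring
  have hshift : eLpNorm (fun x => w j (x + k) - v (x + k)) p (volume.restrict B) ≤
      eLpNorm (fun x => w j x - v x) p (volume.restrict B') := by
    have hmp := (measurePreserving_add_right volume k).restrict_preimage
      (Metric.isClosed_closedBall.measurableSet : MeasurableSet B')
    rw [← eLpNorm_comp_measurePreserving hsub.restrict hmp]
    refine eLpNorm_mono_measure _ (Measure.restrict_mono (fun x hx => ?_) le_rfl)
    have hx' : ‖x‖ ≤ n := mem_closedBall_zero_iff.1 hx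
    exact mem_closedBall_zero_iff.2 ((norm_add_le x k).trans (by linarith))
  rw [h1]
  refine (eLpNorm_add_le ?_ hsub.restrict hp1).trans (add_le_add ?_ le_rfl)
  · exact ((aestronglyMeasurable_comp_add hsub k).neg.add
      (aestronglyMeasurable_add_sub (hw j) k)).restrict
  refine (eLpNorm_add_le (aestronglyMeasurable_comp_add hsub k).neg.restrict
    (aestronglyMeasurable_add_sub (hw j) k).restrict hp1).trans (add_le_add ?_ ?_)
  · exact (eLpNorm_neg _ _ _).le.trans hshift
  · exact (eLpNorm_restrict_le _ _ _ _).trans (hc j)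

end LocalLimit

section DifferenceQuotient

open scoped CompactlySupported

variable {E : Type*} [NormedAddCommGroup E] [NormedSpace ℝ E] [FiniteDimensional ℝ E]
  [MeasurableSpace E] [BorelSpace E] {μ : Measure E} [μ.IsAddHaarMeasure] {p q : ℝ≥0∞}

lemma tendsto_integral_mul_differenceQuotient {φ : E → ℝ} (hφ : ContDiff ℝ 1 φ)
    (hφc : HasCompactSupport φ) {v : E → ℝ} (hv : LocallyIntegrable v μ) (e : E) :
    Tendsto (fun t : ℝ => ∫ x, φ x * (t⁻¹ * (v (x + t • e) - v x)) ∂μ) (𝓝[>] 0)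
      (𝓝 (-∫ x, v x * fderiv ℝ φ x e ∂μ)) := by
  set K := Metric.cthickening ‖e‖ (tsupport φ) with hK
  have hKc : IsCompact K := IsCompact.cthickening hφc
  have hg : Integrable (K.indicator v) μ :=
    (hv.integrableOn_isCompact hKc).integrable_indicator hKc.measurableSet
  obtain ⟨C, hC⟩ := hφ.lipschitzWith_of_hasCompactSupport hφc one_ne_zero
  have hlim := LipschitzWith.integral_inv_smul_sub_mul_tendsto_integral_lineDeriv_mul hC hg (-e)
  have htarget : ∫ x, lineDeriv ℝ φ x (-e) * K.indicator v x ∂μ =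
      -∫ x, v x * fderiv ℝ φ x e ∂μ := by
    rw [← integral_neg]
    refine integral_congr_ae (Eventually.of_forall fun x => ?_)
    have hd : lineDeriv ℝ φ x (-e) = -fderiv ℝ φ x e := by
      rw [((hφ.differentiable one_ne_zero) x).lineDeriv_eq_fderiv, map_neg]
    simp only [hd]
    by_cases hx : x ∈ K
    · rw [indicator_of_mem hx]; ring
    · have : x ∉ tsupport φ := fun h => hx (Metric.self_subset_cthickening _ h)
      have h0 : fderiv ℝ φ x = 0 := image_eq_zero_of_notMem_tsupport
        fun h => this (tsupport_fderiv_subset ℝ h)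
      simp [h0]
  rw [htarget] at hlim
  refine hlim.congr' ?_
  filter_upwards [Ioo_mem_nhdsGT (zero_lt_one' ℝ)] with t ht
  have hint : ∀ s : E, Integrable (fun x => φ (x + s) * v x) μ := fun s =>
    hv.integrable_smul_left_of_hasCompactSupport (hφ.continuous.comp (by fun_prop))
      (hφc.comp_homeomorph (Homeomorph.addRight s))
  have hcomp : (fun x => φ x * v (x + t • e)) =
      (fun x => φ (x + t • -e) * v x) ∘ fun x => x + t • e := by
    funext x; simp
  have hmp := measurePreserving_add_right μ (t • e)
  have hint1 : Integrable (fun x => φ x * v (x + t • e)) μ := by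
    rw [hcomp]; exact hmp.integrable_comp_of_integrable (hint _)
  have hint0 : Integrable (fun x => φ x * v x) μ := by simpa using hint 0
  have heq : ∫ x, φ x * v (x + t • e) ∂μ = ∫ x, φ (x + t • -e) * v x ∂μ := by
    rw [hcomp]
    exact integral_add_right_eq_self (fun x => φ (x + t • -e) * v x) (t • e)
  calc ∫ x, t⁻¹ • (φ (x + t • -e) - φ x) * K.indicator v x ∂μ
      = ∫ x, t⁻¹ * (φ (x + t • -e) * v x - φ x * v x) ∂μ := by
        refine integral_congr_ae (Eventually.of_forall fun x => ?_)
        simp only [smul_eq_mul]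
        by_cases hx : x ∈ K
        · rw [indicator_of_mem hx]; ring
        · have h0 : φ x = 0 := image_eq_zero_of_notMem_tsupport
            fun h => hx (Metric.self_subset_cthickening _ h)
          have h1 : φ (x + t • -e) = 0 := by
            refine image_eq_zero_of_notMem_tsupport fun h => hx ?_
            refine Metric.mem_cthickening_of_dist_le x _ _ _ h ?_
            simp only [smul_neg, dist_self_add_right, norm_neg, norm_smul, Real.norm_eq_abs,
              abs_of_pos ht.1]
            exact mul_le_of_le_one_left (norm_nonneg e) ht.2.le
          rw [h0, h1]; simp
    _ = ∫ x, t⁻¹ * (φ x * v (x + t • e) - φ x * v x) ∂μ := by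
        rw [integral_const_mul, integral_const_mul, integral_sub (hint _) hint0,
          integral_sub hint1 hint0, heq]
    _ = ∫ x, φ x * (t⁻¹ * (v (x + t • e) - v x)) ∂μ := by
        refine integral_congr_ae (Eventually.of_forall fun x => ?_)
        simp only; ring

lemma exists_measures_of_translationGap_le [hpq : p.HolderConjugate q] {v : E → ℝ} (hv : MemLp v p μ)
    {C : ℝ} (hgap : ∀ h, translationGap μ p v h ≤ ENNReal.ofReal (C * ‖h‖)) (e : E) :
    ∃ ν₁ ν₂ : Measure E, ν₁.Regular ∧ ν₂.Regular ∧
      (∀ f : C_c(E, ℝ), ∫⁻ x, ENNReal.ofReal (f x) ∂ν₁ ≤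
        ENNReal.ofReal (C * ‖e‖) * eLpNorm f q μ) ∧
      (∀ f : C_c(E, ℝ), ∫⁻ x, ENNReal.ofReal (f x) ∂ν₂ ≤
        ENNReal.ofReal (C * ‖e‖) * eLpNorm f q μ) ∧
      ∀ φ : E → ℝ, ContDiff ℝ 1 φ → HasCompactSupport φ →
        ∫ x, v x * fderiv ℝ φ x e ∂μ = -(∫ x, φ x ∂ν₁ - ∫ x, φ x ∂ν₂) := by
  set s : ℕ → ℝ := fun n => 1 / ((n : ℝ) + 1) with hs
  have hs0 : ∀ n, 0 < s n := fun n => by positivity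
  set D : ℕ → E → ℝ := fun n x => (s n)⁻¹ * (v (x + s n • e) - v x) with hD
  have hDm : ∀ n, AEStronglyMeasurable (D n) μ := fun n =>
    (aestronglyMeasurable_add_sub hv.1 _).const_mul _
  have hDle : ∀ n, eLpNorm (D n) p μ ≤ ENNReal.ofReal (C * ‖e‖) := by
    intro n
    have h1 : D n = (s n)⁻¹ • fun x => v (x + s n • e) - v x := rfl
    rw [h1, eLpNorm_const_smul, Real.enorm_eq_ofReal (inv_pos.2 (hs0 n)).le]
    refine (mul_le_mul' le_rfl (hgap (s n • e))).trans_eq ?_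
    rw [← ENNReal.ofReal_mul (inv_pos.2 (hs0 n)).le, norm_smul, Real.norm_of_nonneg (hs0 n).le]
    congr 1
    field_simp [(hs0 n).ne']
  have hpart : ∀ σ : ℝ, |σ| = 1 → ∃ ν : Measure E, ν.Regular ∧
      (∀ f : C_c(E, ℝ), Tendsto (fun n => ∫ x, f x * max (σ * D n x) 0 ∂μ) (hyperfilter ℕ)
        (𝓝 (∫ x, f x ∂ν))) ∧
      ∀ f : C_c(E, ℝ), ∫⁻ x, ENNReal.ofReal (f x) ∂ν ≤
        ENNReal.ofReal (C * ‖e‖) * eLpNorm f q μ := by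
    intro σ hσ
    have hle : ∀ n, eLpNorm (fun x => max (σ * D n x) 0) p μ ≤ ENNReal.ofReal (C * ‖e‖) :=
      fun n => (eLpNorm_mono fun x => by
        rw [Real.norm_of_nonneg (le_max_right _ _), Real.norm_eq_abs]
        refine max_le ((le_abs_self _).trans_eq ?_) (abs_nonneg _)
        rw [abs_mul, hσ, one_mul]).trans (hDle n)
    exact exists_measure_tendsto_integral (hyperfilter ℕ) (fun n x => le_max_right _ _)
      (fun n => ⟨((hDm n).const_mul σ).sup aestronglyMeasurable_const,
        (hle n).trans_lt ENNReal.ofReal_lt_top⟩) ENNReal.ofReal_ne_top hle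
  obtain ⟨ν₁, hr₁, ht₁, hb₁⟩ := hpart 1 (by simp)
  obtain ⟨ν₂, hr₂, ht₂, hb₂⟩ := hpart (-1) (by simp)
  refine ⟨ν₁, ν₂, hr₁, hr₂, hb₁, hb₂, fun φ hφ hφc => ?_⟩
  have hDmem : ∀ n, MemLp (D n) p μ := fun n =>
    ⟨hDm n, (hDle n).trans_lt ENNReal.ofReal_lt_top⟩
  let f : C_c(E, ℝ) := ⟨⟨φ, hφ.continuous⟩, hφc⟩
  have hstend : Tendsto s atTop (𝓝[>] 0) :=
    tendsto_nhdsWithin_iff.2 ⟨tendsto_one_div_add_atTop_nhds_zero_nat, Eventually.of_forall hs0⟩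
  have hlim := (tendsto_integral_mul_differenceQuotient hφ hφc
    (hv.locallyIntegrable hpq.one_le) e).comp hstend
  have hlim' := hlim.mono_left (Nat.hyperfilter_le_atTop)
  have heq : ∀ n, ∫ x, φ x * D n x ∂μ = ∫ x, f x * max (1 * D n x) 0 ∂μ -
      ∫ x, f x * max (-1 * D n x) 0 ∂μ := by
    intro n
    have hi : ∀ σ : ℝ, Integrable (fun x => f x * max (σ * D n x) 0) μ := fun σ =>
      compactlySupported_mul_integrable (q := q) ((hDmem n).const_mul σ).pos_part f
    rw [← integral_sub (hi 1) (hi (-1))]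
    refine integral_congr_ae (Eventually.of_forall fun x => ?_)
    simp only [one_mul, neg_one_mul, ← mul_sub]
    congr 1
    rcases le_total 0 (D n x) with h | h
    · rw [max_eq_left h, max_eq_right (by linarith)]; ring
    · rw [max_eq_right h, max_eq_left (by linarith)]; ring
  have hlim2 := ((ht₁ f).sub (ht₂ f)).congr fun n => (heq n).symm
  exact neg_eq_iff_eq_neg.1 (tendsto_nhds_unique hlim' hlim2)

end DifferenceQuotient

section Characterization

variable {N : ℕ} {p : ℝ≥0∞} {v : EuclideanSpace ℝ (Fin N) → ℝ} {C : ℝ}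

lemma memBV_of_translationGap_le (hv : MemLp v 1 volume)
    (hgap : ∀ h, translationGap volume 1 v h ≤ ENNReal.ofReal (C * ‖h‖)) : MemBV v := by
  have : (1 : ℝ≥0∞).HolderConjugate ⊤ := ENNReal.HolderConjugate.one_top
  refine ⟨hv, ?_⟩
  have hex : ∀ i : Fin N, ∃ S : SignedMeasure (EuclideanSpace ℝ (Fin N)),
      ∀ φ : EuclideanSpace ℝ (Fin N) → ℝ, IsTestFunction φ →
        ∫ x, v x * partialDeriv i φ x = -∫ᵛ x, φ x ∂<•S := by
    intro i
    obtain ⟨ν₁, ν₂, hr₁, hr₂, hb₁, hb₂, h⟩ :=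
      exists_measures_of_translationGap_le (q := ⊤) hv hgap (EuclideanSpace.single i 1)
    have hf₁ : IsFiniteMeasure ν₁ := isFiniteMeasure_of_lintegral_le ENNReal.ofReal_ne_top hb₁
    have hf₂ : IsFiniteMeasure ν₂ := isFiniteMeasure_of_lintegral_le ENNReal.ofReal_ne_top hb₂
    refine ⟨ν₁.toSignedMeasure - ν₂.toSignedMeasure, fun φ hφ => ?_⟩
    have hint : ∀ ν : Measure (EuclideanSpace ℝ (Fin N)), IsFiniteMeasure ν → Integrable φ ν :=
      fun ν _ => hφ.1.continuous.integrable_of_hasCompactSupport hφ.2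
    rw [VectorMeasure.integral_sub_vectorMeasure, VectorMeasure.integral_toSignedMeasure,
      VectorMeasure.integral_toSignedMeasure]
    · exact h φ (hφ.1.of_le (by exact_mod_cast le_top)) hφ.2
    · simpa [VectorMeasure.Integrable] using hint ν₁ hf₁
    · simpa [VectorMeasure.Integrable] using hint ν₂ hf₂
  choose S hS using hex
  exact ⟨S, hS⟩

lemma memW1p_of_translationGap_le (hp1 : 1 < p) (hp : p ≠ ⊤) (hv : MemLp v p volume)
    (hgap : ∀ h, translationGap volume p v h ≤ ENNReal.ofReal (C * ‖h‖)) : MemW1p p v := by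
  have hpq : p.HolderConjugate p.conjExponent := ENNReal.HolderConjugate.conjExponent hp1.le
  have hq : p.conjExponent ≠ ⊤ :=
    ((ENNReal.HolderConjugate.lt_top_iff_one_lt p.conjExponent p).2 hp1).ne
  refine ⟨hv, ?_⟩
  have hex : ∀ i : Fin N, ∃ g : EuclideanSpace ℝ (Fin N) → ℝ, MemLp g p volume ∧
      ∀ φ : EuclideanSpace ℝ (Fin N) → ℝ, IsTestFunction φ →
        ∫ x, v x * partialDeriv i φ x = -∫ x, g x * φ x := by
    intro i
    obtain ⟨ν₁, ν₂, hr₁, hr₂, hb₁, hb₂, h⟩ := exists_measures_of_translationGap_le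
      (q := p.conjExponent) hv hgap (EuclideanSpace.single i 1)
    obtain ⟨g₁, hg₁, h₁⟩ := exists_memLp_integral_eq hp hq ENNReal.ofReal_ne_top hb₁
    obtain ⟨g₂, hg₂, h₂⟩ := exists_memLp_integral_eq hp hq ENNReal.ofReal_ne_top hb₂
    refine ⟨g₁ - g₂, hg₁.sub hg₂, fun φ hφ => ?_⟩
    have hint : ∀ g : EuclideanSpace ℝ (Fin N) → ℝ, MemLp g p volume →
        Integrable (fun x => g x * φ x) volume := fun g hg =>
      (compactlySupported_mul_integrable (q := p.conjExponent) hg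
        ⟨⟨φ, hφ.1.continuous⟩, hφ.2⟩).congr (Eventually.of_forall fun x => mul_comm _ _)
    have h3 := h φ (hφ.1.of_le (by exact_mod_cast le_top)) hφ.2
    rw [h₁, h₂, ← integral_sub (hint g₁ hg₁) (hint g₂ hg₂)] at h3
    refine h3.trans ?_
    simp only [Pi.sub_apply, sub_mul]
  choose g hg hgi using hex
  refine ⟨fun x => WithLp.toLp 2 fun i => g i x, ?_, fun i φ hφ => by simpa using hgi i φ hφ⟩
  have hsum : (fun x => WithLp.toLp 2 fun i => g i x) =
      fun x => ∑ i, g i x • EuclideanSpace.single i (1 : ℝ) := by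
    funext x
    ext j
    simp [Pi.single_apply]
  rw [hsum]
  refine memLp_finsetSum _ fun i _ => ?_
  exact (ContinuousLinearMap.toSpanSingleton ℝ (EuclideanSpace.single i (1 : ℝ))).comp_memLp' (hg i)

end Characterization

end BBM

end

theorem theorem1p3 {N : ℕ} (hN : 1 ≤ N) (p : ℝ≥0∞) [Fact (1 ≤ p)] (hp : p ≠ ⊤)
    (K : EuclideanSpace ℝ (Fin N) → ℝ≥0∞) (hK : AEMeasurable K volume)
    (hK0 : ¬ K =ᵐ[volume] 0)
    (hKp : ∫⁻ x, ‖x‖ₑ ^ p.toReal * K x < ⊤)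
    (β : ℝ → ℝ) (hβ_meas : Measurable fun s : Ioo (0 : ℝ) 1 => β s)
    (hβ_pos : ∀ t ∈ Ioo (0 : ℝ) 1, 0 < β t)
    (hβ_lim : Tendsto β (𝓝[>] 0) atTop)
    (t : ℕ → ℝ) (ht : ∀ k, t k ∈ Ioo (0 : ℝ) 1) (ht0 : Tendsto t atTop (𝓝 0))
    (u : ℕ → Lp ℝ p (volume : Measure (EuclideanSpace ℝ (Fin N))))
    (hu : ⨆ k, (eLpNorm (u k) p volume + BBM.energy p (BBM.rho p K β (t k)) (u k)) < ⊤) :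
    BBM.LocallyPrecompact p (range u) ∧
      ∀ (σ : ℕ → ℕ) (v : EuclideanSpace ℝ (Fin N) → ℝ), StrictMono σ → BBM.MemLpLoc p v →
        BBM.TendstoLpLoc p (fun j => u (σ j)) v → BBM.MemS p v := by
  have hp1 : 1 ≤ p := Fact.out
  set S := ⨆ k, (eLpNorm (u k) p volume + BBM.energy p (BBM.rho p K β (t k)) (u k)) with hS
  have hkS : ∀ k, eLpNorm (u k) p volume + BBM.energy p (BBM.rho p K β (t k)) (u k) ≤ S :=
    fun k => le_iSup (fun k => eLpNorm (u k) p volume +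
      BBM.energy p (BBM.rho p K β (t k)) (u k)) k
  have hnorm : ∀ k, eLpNorm (u k) p volume ≤ S := fun k => le_self_add.trans (hkS k)
  obtain ⟨C, hC, hCgap⟩ := BBM.exists_translationGap_le_of_energy_le hp1 hp hK hK0 hKp hu.ne
  have hgap : ∀ k h, BBM.translationGap volume p (u k) h ≤
      ENNReal.ofReal (C * (‖h‖ + (β (t k))⁻¹)) := fun k h =>
    hCgap β (t k) (u k) (hβ_pos _ (ht k)) (Lp.stronglyMeasurable (u k)).measurable
      (le_add_self.trans (hkS k)) h
  have hβt : Tendsto (fun k => (β (t k))⁻¹) atTop (𝓝 0) :=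
    tendsto_inv_atTop_zero.comp (hβ_lim.comp (tendsto_nhdsWithin_iff.2
      ⟨ht0, Eventually.of_forall fun k => (ht k).1⟩))
  refine ⟨BBM.locallyPrecompact_range_of_translationGap hp u (R := S.toReal) (fun k => ?_)
    fun ε hε => ?_, fun σ v hσ hv hlim => ?_⟩
  · rw [Lp.norm_def]
    exact ENNReal.toReal_mono hu.ne (hnorm k)
  · have hδ : 0 < ε / (2 * (C + 1)) := by positivity
    obtain ⟨k₀, hk₀⟩ := eventually_atTop.1 (hβt.eventually (gt_mem_nhds hδ))
    refine ⟨_, hδ, k₀, fun k hk h hh => (hgap k h).trans (ENNReal.ofReal_le_ofReal ?_)⟩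
    have hsum : ‖h‖ + (β (t k))⁻¹ ≤ ε / (2 * (C + 1)) + ε / (2 * (C + 1)) :=
      add_le_add hh (hk₀ k hk).le
    calc C * (‖h‖ + (β (t k))⁻¹)
        ≤ (C + 1) * (ε / (2 * (C + 1)) + ε / (2 * (C + 1))) :=
          mul_le_mul (by linarith) hsum
            (add_nonneg (norm_nonneg h) (inv_pos.2 (hβ_pos _ (ht k))).le) (by linarith)
      _ = ε := by field_simp; ring
  · have hmeas : ∀ j, AEStronglyMeasurable (u (σ j)) volume := fun j =>
      Lp.aestronglyMeasurable (u (σ j))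
    have hvp : MemLp v p volume := ⟨hv.aestronglyMeasurable,
      (hlim.eLpNorm_le hp1 hv hmeas fun j => hnorm (σ j)).trans_lt hu⟩
    have hvgap : ∀ h, BBM.translationGap volume p v h ≤ ENNReal.ofReal (C * ‖h‖) := by
      intro h
      have hc : Tendsto (fun j => ENNReal.ofReal (C * (‖h‖ + (β (t (σ j)))⁻¹))) atTop
          (𝓝 (ENNReal.ofReal (C * (‖h‖ + 0)))) :=
        ENNReal.tendsto_ofReal
          ((tendsto_const_nhds.add (hβt.comp hσ.tendsto_atTop)).const_mul C)
      rw [add_zero] at hc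
      exact hlim.translationGap_le hp1 hv hmeas h hc fun j => hgap (σ j) h
    unfold BBM.MemS
    split_ifs with h1
    · subst h1
      exact BBM.memBV_of_translationGap_le hvp hvgap
    · exact BBM.memW1p_of_translationGap_le (lt_of_le_of_ne hp1 (Ne.symm h1)) hp hvp hvgap
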